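/- **Conventions.** All vector lattices and linear maps are real; vector lattice homomorphisms are linear maps preserving finite suprema and infima. $\langle A\rangle$ is the vector sublattice generated by $A$. For $m\ge 1$, $\mathcal{H}(\mathbb{R}^m)$ is the set of continuous $h:\mathbb{R}^m\to\mathbb{R}$ with $h(\lambda x)=\lambda h(x)$ for all real $\lambda\ge 0$ and all $x\in\mathbb{R}^m$; write $\delta(h)=m$ for $h\in\mathcal{H}(\mathbb{R}^m)$. For an Archimedean vector lattice $F$, $a_1,\dots,a_m,b\in F$ and $h\in\mathcal{H}(\mathbb{R}^m)$, we write $h(a_1,\dots,a_m)=b$ if $h(\omega(a_1),\dots,\omega(a_m))=\omega(b)$ for every nonzero vector lattice homomorphism $\omega:\langle a_1,\dots,a_m,b\rangle\to\mathbb{R}$. For a set $\mathcal{D}\subseteq\bigcup_{m\ge1}\mathcal{H}(\mathbb{R}^m)$, $F$ is *$\mathcal{D}$-complete* if for all $h\in\mathcal{D}$ and $a_1,\dots,a_{\delta(h)}\in F$ there is $b\in F$ with $h(a_1,\dots,a_{\delta(h)})=b$. $F$ is *uniformly complete* if every relatively uniformly Cauchy sequence $(f_n)$ in $F$ (for some $p>0$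 in $F$ and every $\varepsilon>0$, eventually $|f_m-f_n|<\varepsilon p$) converges relatively uniformly to some $f\in F$ (for some $p>0$ in $F$ and every $\varepsilon>0$, eventually $|f_n-f|<\varepsilon p$). A *$\mathcal{D}$-completion* of an Archimedean vector lattice $E$ is a pair $(G,\phi)$ such that $G$ is a $\mathcal{D}$-complete Archimedean vector lattice, $\phi:E\to G$ is an injective vector lattice homomorphism, and for every $\mathcal{D}$-complete Archimedean vector lattice $F$ and every vector lattice homomorphism $T:E\to F$ there is a unique vector lattice homomorphism $S:G\to F$ with $S\circ\phi=T$. A *uniform completion* of $E$ is defined in the same way with "uniformly complete" in place of "$\mathcal{D}$-complete". **Corollary 3.19.** Let $E$ be an Archimedean vector lattice and let $\mathcal{D}\subseteq\bigcup_{m\ge1}\mathcal{H}(\mathbb{R}^m)$ be nonempty. Then $E$ has a uniform completion. Let $(E^u,\phi)$ be any uniform completion of $E$, put $E_1=\phi(E)$ and, for $n\ge1$, $$E_{n+1}=\big\langle E_n\cup\{b\in E^u : b=h(a_1,\dots,a_{\delta(h)})\text{ for some }h\in\mathcal{D},\ a_1,\dots,a_{\delta(h)}\in E_n\}\big\rangle\subseteq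 E^u,$$ and let $E^{\mathcal{D}}=\bigcup_{n\ge1}E_n$, with natural embedding $\iota:E\to E^{\mathcal{D}}$, $\iota(x)=\phi(x)$. Then $(E^{\mathcal{D}},\iota)$ is a $\mathcal{D}$-completion of $E$, and it is the unique one: for every $\mathcal{D}$-completion $(G,\psi)$ of $E$ there is a unique vector lattice isomorphism $e:E^{\mathcal{D}}\to G$ with $e\circ\iota=\psi$. -/

import Mathlib

/-!  Vector lattices are real vector spaces with a lattice order, given by Mathlib's classes
`AddCommGroup`, `Lattice`, `Module ℝ`, `IsOrderedAddMonoid`, `IsOrderedModule ℝ`. -/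

universe u v w

namespace FunctionalCompletion

section Basic

variable (E : Type*) [AddCommGroup E] [Lattice E] [Module ℝ E]

/-- The Archimedean property of a vector lattice: if all multiples `n x` lie below a fixed `y`,
then `x ≤ 0`.  (Mathlib's `Archimedean` is a different, much stronger condition on partially
ordered groups.) -/
def IsArchimedean : Prop :=
  ∀ x y : E, (∀ n : ℕ, n • x ≤ y) → x ≤ 0

variable {E}

/-- `f n` converges relatively uniformly to `g`. -/
def RUConverges (f : ℕ → E) (g : E) : Prop :=
  ∃ p : E, 0 < p ∧ ∀ ε : ℝ, 0 < ε → ∃ N : ℕ, ∀ n, N ≤ n → |f n - g| < ε • p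

/-- `f` is a relatively uniformly Cauchy sequence. -/
def RUCauchy (f : ℕ → E) : Prop :=
  ∃ p : E, 0 < p ∧ ∀ ε : ℝ, 0 < ε →
    ∃ N : ℕ, ∀ m n, N ≤ m → N ≤ n → |f m - f n| < ε • p

variable (E) in
/-- Uniform completeness of a vector lattice. -/
def UniformlyComplete : Prop :=
  ∀ f : ℕ → E, RUCauchy f → ∃ g : E, RUConverges f g

end Basic

/-- Vector lattice homomorphisms: linear maps that preserve finite suprema and infima. -/
structure VLHom (E F : Type*) [AddCommGroup E] [Lattice E] [Module ℝ E]
    [AddCommGroup F] [Lattice F] [Module ℝ F] extends E →ₗ[ℝ] F where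
  map_sup' : ∀ x y : E, toFun (x ⊔ y) = toFun x ⊔ toFun y
  map_inf' : ∀ x y : E, toFun (x ⊓ y) = toFun x ⊓ toFun y

instance VLHom.instFunLike {E F : Type*} [AddCommGroup E] [Lattice E] [Module ℝ E]
    [AddCommGroup F] [Lattice F] [Module ℝ F] : FunLike (VLHom E F) E F where
  coe T := T.toLinearMap
  coe_injective := by
    rintro ⟨S, _, _⟩ ⟨T, _, _⟩ h
    obtain rfl : S = T := DFunLike.coe_injective h
    rfl

/-- Vector sublattices: linear subspaces closed under the lattice operations. -/
structure VectorSublattice (E : Type*) [AddCommGroup E] [Lattice E] [Module ℝ E]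
    extends Submodule ℝ E where
  sup_mem' : ∀ x y : E, x ∈ carrier → y ∈ carrier → x ⊔ y ∈ carrier
  inf_mem' : ∀ x y : E, x ∈ carrier → y ∈ carrier → x ⊓ y ∈ carrier

namespace VectorSublattice

variable {E : Type*} [AddCommGroup E] [Lattice E] [Module ℝ E]

instance instSetLike : SetLike (VectorSublattice E) E where
  coe L := L.carrier
  coe_injective := by
    rintro ⟨L, _, _⟩ ⟨M, _, _⟩ h
    obtain rfl : L = M := SetLike.coe_injective h
    rfl

instance instAddSubgroupClass : AddSubgroupClass (VectorSublattice E) E where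
  add_mem {L} _ _ hx hy := L.toSubmodule.add_mem hx hy
  zero_mem L := L.toSubmodule.zero_mem
  neg_mem {L} _ hx := L.toSubmodule.neg_mem hx

instance instSMulMemClass : SMulMemClass (VectorSublattice E) ℝ E where
  smul_mem {L} c _ hx := L.toSubmodule.smul_mem c hx

/-- The lattice operations of a vector sublattice are those of the ambient space. -/
instance instLattice (L : VectorSublattice E) : Lattice L :=
  Subtype.lattice (fun {x y} hx hy => L.sup_mem' x y hx hy)
    (fun {x y} hx hy => L.inf_mem' x y hx hy)

instance instIsOrderedAddMonoid [IsOrderedAddMonoid E] (L : VectorSublattice E) :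
    IsOrderedAddMonoid L where
  add_le_add_left _ _ h c := add_le_add_left (α := E) h c

instance instIsOrderedModule [IsOrderedAddMonoid E] [IsOrderedModule ℝ E]
    (L : VectorSublattice E) : IsOrderedModule ℝ L where
  smul_le_smul_of_nonneg_left _ ha _ _ hb := smul_le_smul_of_nonneg_left (β := E) hb ha
  smul_le_smul_of_nonneg_right _ hb _ _ ha := smul_le_smul_of_nonneg_right (β := E) ha hb

/-- The vector sublattice `⟨A⟩` generated by a set `A`: the intersection of all vector
sublattices that contain `A`. -/
def closure (A : Set E) : VectorSublattice E where
  carrier := {x | ∀ L : VectorSublattice E, A ⊆ L → x ∈ L}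
  add_mem' hx hy L hL := add_mem (hx L hL) (hy L hL)
  zero_mem' L _ := zero_mem L
  smul_mem' c _ hx L hL := SMulMemClass.smul_mem c (hx L hL)
  sup_mem' x y hx hy L hL := L.sup_mem' x y (hx L hL) (hy L hL)
  inf_mem' x y hx hy L hL := L.inf_mem' x y (hx L hL) (hy L hL)

theorem subset_closure (A : Set E) : A ⊆ closure A := fun _ hx _ hL => hL hx

/-- The union of an increasing sequence of vector sublattices. -/
def iUnionOfMonotone (L : ℕ → VectorSublattice E) (hL : ∀ n, (L n : Set E) ⊆ L (n + 1)) :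
    VectorSublattice E :=
  have hmono : ∀ {m n : ℕ}, m ≤ n → (L m : Set E) ⊆ L n :=
    fun {_ _} h => monotone_nat_of_le_succ (f := fun n => (L n : Set E)) hL h
  have hpair : ∀ {x y : E}, (∃ n, x ∈ L n) → (∃ n, y ∈ L n) → ∃ n, x ∈ L n ∧ y ∈ L n := by
    rintro x y ⟨m, hm⟩ ⟨n, hn⟩
    exact ⟨max m n, hmono (le_max_left m n) hm, hmono (le_max_right m n) hn⟩
  { carrier := {x | ∃ n, x ∈ L n}
    add_mem' := fun hx hy => (hpair hx hy).imp fun _ h => add_mem h.1 h.2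
    zero_mem' := ⟨0, zero_mem (L 0)⟩
    smul_mem' := fun c _ hx => hx.imp fun _ h => SMulMemClass.smul_mem c h
    sup_mem' := fun x y hx hy => (hpair hx hy).imp fun n h => (L n).sup_mem' x y h.1 h.2
    inf_mem' := fun x y hx hy => (hpair hx hy).imp fun n h => (L n).inf_mem' x y h.1 h.2 }

end VectorSublattice

/-- The range of a vector lattice homomorphism. -/
def VLHom.range {E F : Type*} [AddCommGroup E] [Lattice E] [Module ℝ E]
    [AddCommGroup F] [Lattice F] [Module ℝ F] (φ : VLHom E F) : VectorSublattice F where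
  toSubmodule := LinearMap.range φ.toLinearMap
  sup_mem' := by
    rintro _ _ ⟨x, rfl⟩ ⟨y, rfl⟩
    exact ⟨x ⊔ y, φ.map_sup' x y⟩
  inf_mem' := by
    rintro _ _ ⟨x, rfl⟩ ⟨y, rfl⟩
    exact ⟨x ⊓ y, φ.map_inf' x y⟩

/-- A vector lattice homomorphism with values in a vector sublattice, regarded as a map into
that sublattice. -/
def VLHom.codRestrict {E F : Type*} [AddCommGroup E] [Lattice E] [Module ℝ E]
    [AddCommGroup F] [Lattice F] [Module ℝ F] (φ : VLHom E F) (L : VectorSublattice F)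
    (hL : ∀ x, φ x ∈ L) : VLHom E L where
  toFun x := ⟨φ x, hL x⟩
  map_add' x y := Subtype.ext (φ.map_add' x y)
  map_smul' c x := Subtype.ext (φ.map_smul' c x)
  map_sup' x y := Subtype.ext (φ.map_sup' x y)
  map_inf' x y := Subtype.ext (φ.map_inf' x y)

/-- The union over all `m ≥ 1` of the spaces `H(ℝ^m)` of continuous positively-homogeneous
real functions on `ℝ^m`; an element carries its number `arity` of variables. -/
structure HFun where
  arity : ℕ
  arity_pos : 0 < arity
  toFun : (Fin arity → ℝ) → ℝ
  continuous : Continuous toFun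
  homogeneous : ∀ (c : ℝ) (x : Fin arity → ℝ), 0 ≤ c → toFun (c • x) = c * toFun x

section Calculus

variable {E : Type*} [AddCommGroup E] [Lattice E] [Module ℝ E]

/-- The relation `h(a₁, …, a_m) = b` of functional calculus:
`h(ω(a₁), …, ω(a_m)) = ω(b)` for every nonzero real-valued vector lattice homomorphism `ω` on
the vector sublattice generated by `a₁, …, a_m, b`. -/
def CalcEq (h : HFun) (a : Fin h.arity → E) (b : E) : Prop :=
  ∀ ω : VLHom (VectorSublattice.closure (Set.range a ∪ {b})) ℝ, (∃ x, ω x ≠ 0) →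
    h.toFun (fun i => ω ⟨a i, VectorSublattice.subset_closure _ (Or.inl ⟨i, rfl⟩)⟩) =
      ω ⟨b, VectorSublattice.subset_closure _ (Or.inr rfl)⟩

variable (E) in
/-- `E` is `D`-complete: `h(a₁, …, a_m)` exists in `E` for all `h ∈ D` and `a₁, …, a_m ∈ E`. -/
def DComplete (D : Set HFun) : Prop :=
  ∀ h ∈ D, ∀ a : Fin h.arity → E, ∃ b : E, CalcEq h a b

end Calculus

section Completions

variable {E : Type u} [AddCommGroup E] [Lattice E] [Module ℝ E]
  {G : Type v} [AddCommGroup G] [Lattice G] [Module ℝ G]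

/-- `(G, φ)` is a uniform completion of `E`; the universal property is tested on uniformly
complete Archimedean vector lattices in `Type w`. -/
structure IsUniformCompletion (φ : VLHom E G) : Prop where
  archimedean : IsArchimedean G
  uniformlyComplete : UniformlyComplete G
  injective : Function.Injective φ
  universal : ∀ (F : Type w) [AddCommGroup F] [Lattice F] [Module ℝ F] [IsOrderedAddMonoid F]
    [IsOrderedModule ℝ F], IsArchimedean F → UniformlyComplete F →
    ∀ T : VLHom E F, ∃! S : VLHom G F, ∀ x : E, S (φ x) = T x

/-- `(G, φ)` is a `D`-completion of `E`; the universal property is tested on `D`-complete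
Archimedean vector lattices in `Type w`. -/
structure IsDCompletion (D : Set HFun) (φ : VLHom E G) : Prop where
  archimedean : IsArchimedean G
  dComplete : DComplete G D
  injective : Function.Injective φ
  universal : ∀ (F : Type w) [AddCommGroup F] [Lattice F] [Module ℝ F] [IsOrderedAddMonoid F]
    [IsOrderedModule ℝ F], IsArchimedean F → DComplete F D →
    ∀ T : VLHom E F, ∃! S : VLHom G F, ∀ x : E, S (φ x) = T x

/-- One step of the construction: the vector sublattice generated by `L` and all elements
`h(a₁, …, a_m)` with `h ∈ D` and `a₁, …, a_m ∈ L`. -/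
def dStep (D : Set HFun) (L : VectorSublattice G) : VectorSublattice G :=
  VectorSublattice.closure ((L : Set G) ∪
    {b | ∃ h ∈ D, ∃ a : Fin h.arity → G, (∀ i, a i ∈ L) ∧ CalcEq h a b})

/-- The chain `E₁ = φ(E) ⊆ E₂ ⊆ …` (indexed from `0`) of vector sublattices of `G`. -/
def dChain (D : Set HFun) (φ : VLHom E G) : ℕ → VectorSublattice G
  | 0 => φ.range
  | n + 1 => dStep D (dChain D φ n)

theorem dChain_subset_succ (D : Set HFun) (φ : VLHom E G) (n : ℕ) :
    (dChain D φ n : Set G) ⊆ dChain D φ (n + 1) :=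
  fun _ hx => VectorSublattice.subset_closure _ (Or.inl hx)

/-- The space `E^D`: the union of the chain `dChain D φ`.  It is used when `(G, φ)` is a uniform
completion of `E`. -/
def dHull (D : Set HFun) (φ : VLHom E G) : VectorSublattice G :=
  VectorSublattice.iUnionOfMonotone (dChain D φ) (dChain_subset_succ D φ)

/-- The natural embedding of `E` into `E^D`. -/
def toDHull (D : Set HFun) (φ : VLHom E G) : VLHom E (dHull D φ) :=
  φ.codRestrict (dHull D φ) fun x => ⟨0, ⟨x, rfl⟩⟩

end Completions

end FunctionalCompletion

/-!
An Archimedean vector lattice `E` need not admit any real-valued homomorphism, but on each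
countably generated vector sublattice there are enough of them to separate points: a
Rasiowa–Sikorski argument yields an ideal of "supports" modulo which countably many elements have
real values relative to a given `x > 0`. Hence `E` embeds, functorially, in the algebra of germs of
real functions along the filter generated by the homomorphisms on countably generated sublattices.
This filter is stable under countable intersections, so its germs are Archimedean and uniformly
complete, and the relatively uniform closure of `E` in them is a uniform completion.

In a uniformly complete `U`, the functional calculus of a continuous positively homogeneous `h`
exists because, by the lattice form of the Stone–Weierstrass theorem on the unit sphere, `h` is a
uniform limit of lattice combinations of linear functionals. So `E^D` is `D`-complete when `U` is a
uniform completion of `E`. A homomorphism from `E` into a `D`-complete `F` extends to `U`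
with values in the germs on `F`, and this extension carries `E^D` into `F` because functional
calculus is preserved by homomorphisms and has unique values.
-/

namespace FunctionalCompletion

section Homomorphisms

variable {E F G : Type*} [AddCommGroup E] [Lattice E] [Module ℝ E]
  [AddCommGroup F] [Lattice F] [Module ℝ F] [AddCommGroup G] [Lattice G] [Module ℝ G]

namespace VLHom

instance instLinearMapClass : LinearMapClass (VLHom E F) ℝ E F where
  map_add T := T.map_add'
  map_smulₛₗ T := T.map_smul'

instance instLatticeHomClass : LatticeHomClass (VLHom E F) E F where
  map_sup T := T.map_sup'
  map_inf T := T.map_inf'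

theorem map_abs (T : VLHom E F) (x : E) : T |x| = |T x| := by
  simp only [abs, map_sup, map_neg]

theorem ext {S T : VLHom E F} (h : ∀ x, S x = T x) : S = T :=
  DFunLike.ext _ _ h

theorem le_iff_le_of_injective (T : VLHom E F) (hT : Function.Injective T) {x y : E} :
    T x ≤ T y ↔ x ≤ y := by
  rw [← sup_eq_right, ← map_sup, hT.eq_iff, sup_eq_right]

/-- Composition of vector lattice homomorphisms. -/
def comp (S : VLHom F G) (T : VLHom E F) : VLHom E G where
  toLinearMap := S.toLinearMap.comp T.toLinearMap
  map_sup' x y := show S (T (x ⊔ y)) = S (T x) ⊔ S (T y) by rw [map_sup, map_sup]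
  map_inf' x y := show S (T (x ⊓ y)) = S (T x) ⊓ S (T y) by rw [map_inf, map_inf]

@[simp]
theorem comp_apply (S : VLHom F G) (T : VLHom E F) (x : E) : S.comp T x = S (T x) := rfl

/-- The identity as a vector lattice homomorphism. -/
protected def id : VLHom E E where
  toLinearMap := LinearMap.id
  map_sup' _ _ := rfl
  map_inf' _ _ := rfl

/-- The factorization of `S` through an injective homomorphism `j` whose range contains that
of `S`. -/
noncomputable def lift (j : VLHom F G) (hj : Function.Injective j) (S : VLHom E G)
    (hS : ∀ x, S x ∈ j.range) : VLHom E F :=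
  have spec : ∀ x, j (hS x).choose = S x := fun x => (hS x).choose_spec
  { toFun := fun x => (hS x).choose
    map_add' := fun x y => hj ((spec _).trans (by rw [map_add, map_add, spec, spec]))
    map_smul' := fun c x => hj ((spec _).trans (by rw [map_smul, RingHom.id_apply, map_smul, spec]))
    map_sup' := fun x y => hj ((spec _).trans (by rw [map_sup, map_sup, spec, spec]))
    map_inf' := fun x y => hj ((spec _).trans (by rw [map_inf, map_inf, spec, spec])) }

@[simp]
theorem apply_lift (j : VLHom F G) (hj : Function.Injective j) (S : VLHom E G)
    (hS : ∀ x, S x ∈ j.range) (x : E) : j (lift j hj S hS x) = S x :=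
  (hS x).choose_spec

end VLHom

namespace VectorSublattice

/-- The inclusion of a vector sublattice. -/
def subtype (L : VectorSublattice E) : VLHom L E where
  toLinearMap := L.toSubmodule.subtype
  map_sup' _ _ := rfl
  map_inf' _ _ := rfl

/-- The inclusion of a vector sublattice in a larger one. -/
def inclusion {L M : VectorSublattice E} (h : (L : Set E) ⊆ M) : VLHom L M :=
  L.subtype.codRestrict M fun x => h x.2

theorem closure_le {A : Set E} {L : VectorSublattice E} (h : A ⊆ L) :
    (closure A : Set E) ⊆ L := fun _ hx => hx L h

theorem closure_mono {A B : Set E} (h : A ⊆ B) : (closure A : Set E) ⊆ closure B :=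
  closure_le (h.trans (subset_closure B))

theorem sup_mem (L : VectorSublattice E) {x y : E} (hx : x ∈ L) (hy : y ∈ L) : x ⊔ y ∈ L :=
  L.sup_mem' x y hx hy

theorem inf_mem (L : VectorSublattice E) {x y : E} (hx : x ∈ L) (hy : y ∈ L) : x ⊓ y ∈ L :=
  L.inf_mem' x y hx hy

theorem smul_mem (L : VectorSublattice E) (c : ℝ) {x : E} (hx : x ∈ L) : c • x ∈ L :=
  SMulMemClass.smul_mem c hx

/-- The preimage of a vector sublattice under a vector lattice homomorphism. -/
def comap (T : VLHom E F) (L : VectorSublattice F) : VectorSublattice E where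
  toSubmodule := L.toSubmodule.comap T.toLinearMap
  sup_mem' x y hx hy := show T (x ⊔ y) ∈ L by rw [map_sup]; exact L.sup_mem hx hy
  inf_mem' x y hx hy := show T (x ⊓ y) ∈ L by rw [map_inf]; exact L.inf_mem hx hy

/-- The image of a vector sublattice under a vector lattice homomorphism. -/
def map (T : VLHom E F) (L : VectorSublattice E) : VectorSublattice F :=
  (T.comp L.subtype).range

theorem mem_map {T : VLHom E F} {L : VectorSublattice E} {y : F} :
    y ∈ map T L ↔ ∃ x ∈ L, T x = y :=
  ⟨fun ⟨x, hx⟩ => ⟨x, x.2, hx⟩, fun ⟨x, hx, h⟩ => ⟨⟨x, hx⟩, h⟩⟩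

/-- The vector sublattice on which two vector lattice homomorphisms agree. -/
def eqLocus (S T : VLHom E F) : VectorSublattice E where
  toSubmodule := LinearMap.eqLocus S.toLinearMap T.toLinearMap
  sup_mem' x y hx hy := show S (x ⊔ y) = T (x ⊔ y) by
    rw [map_sup, map_sup, show S x = T x from hx, show S y = T y from hy]
  inf_mem' x y hx hy := show S (x ⊓ y) = T (x ⊓ y) by
    rw [map_inf, map_inf, show S x = T x from hx, show S y = T y from hy]

end VectorSublattice

end Homomorphisms

section Archimedean

variable {E : Type*} [AddCommGroup E] [Lattice E]

theorem inf_add_le_add_inf [IsOrderedAddMonoid E] {u b c : E} (hu : 0 ≤ u) (hb : 0 ≤ b)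
    (hc : 0 ≤ c) : u ⊓ (b + c) ≤ u ⊓ b + u ⊓ c := by
  rw [add_inf, inf_add, inf_add]
  refine le_inf (le_inf ?_ ?_) (le_inf ?_ inf_le_right)
  · exact inf_le_left.trans (le_add_of_nonneg_left hu)
  · exact inf_le_left.trans (le_add_of_nonneg_left hb)
  · exact inf_le_left.trans (le_add_of_nonneg_right hc)

theorem inf_sup_nonpos [IsOrderedAddMonoid E] {u b c : E} (hb : u ⊓ b ≤ 0) (hc : u ⊓ c ≤ 0) :
    u ⊓ (b ⊔ c) ≤ 0 := by
  let := AddCommGroup.toDistribLattice E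
  exact inf_sup_left u b c ▸ sup_le hb hc

theorem inf_posPart_nonpos [IsOrderedAddMonoid E] {u b : E} (hb : u ⊓ b ≤ 0) : u ⊓ b⁺ ≤ 0 :=
  inf_sup_nonpos hb inf_le_right

variable [Module ℝ E]

theorem IsArchimedean.of_injective {F : Type*} [AddCommGroup F] [Lattice F] [Module ℝ F]
    (hE : IsArchimedean E) (T : VLHom F E) (hT : Function.Injective T) : IsArchimedean F := by
  intro x y h
  rw [← T.le_iff_le_of_injective hT, map_zero]
  refine hE (T x) (T y) fun n => ?_
  rw [← map_nsmul, T.le_iff_le_of_injective hT]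
  exact h n

theorem isArchimedean_real : IsArchimedean ℝ := by
  intro x y hxy
  by_contra! hx
  obtain ⟨n, hn⟩ := Archimedean.arch (y + 1) hx
  linarith [hxy n]

theorem VectorSublattice.isArchimedean (L : VectorSublattice E) (hE : IsArchimedean E) :
    IsArchimedean L :=
  hE.of_injective L.subtype Subtype.coe_injective

variable [IsOrderedAddMonoid E] [IsOrderedModule ℝ E]

theorem IsArchimedean.nonpos_of_forall_le_smul (hE : IsArchimedean E) {x p : E}
    (h : ∀ ε : ℝ, 0 < ε → x ≤ ε • p) : x ≤ 0 := by
  refine hE x |p| fun n => ?_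
  rcases Nat.eq_zero_or_pos n with rfl | hn
  · rw [zero_smul]
    exact abs_nonneg p
  · have hn' : (0 : ℝ) < n := Nat.cast_pos.2 hn
    calc n • x = (n : ℝ) • x := (Nat.cast_smul_eq_nsmul ℝ n x).symm
      _ ≤ (n : ℝ) • ((n : ℝ)⁻¹ • p) := smul_le_smul_of_nonneg_left (h _ (inv_pos.2 hn')) hn'.le
      _ = p := smul_inv_smul₀ hn'.ne' p
      _ ≤ |p| := le_abs_self p

theorem IsArchimedean.le_of_forall_le_add_smul (hE : IsArchimedean E) {x y p : E}
    (h : ∀ ε : ℝ, 0 < ε → x ≤ y + ε • p) : x ≤ y :=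
  sub_nonpos.1 <| hE.nonpos_of_forall_le_smul fun ε hε => sub_le_iff_le_add'.2 (h ε hε)

/-- The cone of the elements that are nonpositive on the support of `u`; for `u ≥ 0` the condition
`u ⊓ b ≤ 0` says that `u` and `b⁺` are disjoint. -/
def nonposCone (u : E) (hu : 0 ≤ u) : PointedCone ℝ E where
  carrier := {b | u ⊓ b ≤ 0}
  zero_mem' := inf_le_right
  add_mem' {b c} hb hc := by
    calc u ⊓ (b + c) ≤ u ⊓ (b⁺ + c⁺) :=
          inf_le_inf_left u (add_le_add (le_posPart b) (le_posPart c))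
      _ ≤ u ⊓ b⁺ + u ⊓ c⁺ := inf_add_le_add_inf hu (posPart_nonneg b) (posPart_nonneg c)
      _ ≤ 0 := add_nonpos (inf_posPart_nonpos hb) (inf_posPart_nonpos hc)
  smul_mem' := by
    rintro ⟨r, hr⟩ b hb
    have hs : 0 < max 1 r := lt_max_of_lt_left one_pos
    calc u ⊓ r • b ≤ max 1 r • u ⊓ max 1 r • b⁺ := by
          refine inf_le_inf ?_ ?_
          · simpa only [one_smul] using smul_le_smul_of_nonneg_right (le_max_left 1 r) hu
          · exact (smul_le_smul_of_nonneg_left (le_posPart b) hr).trans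
              (smul_le_smul_of_nonneg_right (le_max_right 1 r) (posPart_nonneg b))
      _ = max 1 r • (u ⊓ b⁺) := ((OrderIso.smulRight hs).map_inf u b⁺).symm
      _ ≤ 0 := smul_nonpos_of_nonneg_of_nonpos hs.le (inf_posPart_nonpos hb)

section NonposCone

variable {u : E} {hu : 0 ≤ u}

theorem isLowerSet_nonposCone : IsLowerSet (nonposCone u hu : Set E) :=
  fun _ _ hcb hb => (inf_le_inf_left u hcb).trans hb

theorem nonposCone_anti {v : E} {hv : 0 ≤ v} (h : v ≤ u) : nonposCone u hu ≤ nonposCone v hv :=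
  fun _ hb => (inf_le_inf_right _ h).trans hb

theorem nonpos_of_mem_nonposCone {b : E} (hb : b ∈ nonposCone u hu) {c : ℝ} (hc : 0 < c)
    (h : b ≤ c • u) : b ≤ 0 := by
  have hmem : c⁻¹ • b ∈ nonposCone u hu := (nonposCone u hu).smul_mem (inv_pos.2 hc).le hb
  have hle : c⁻¹ • b ≤ u := (inv_smul_le_iff_of_pos hc).2 h
  have hinv : c⁻¹ • b ≤ 0 := inf_eq_right.2 hle ▸ hmem
  simpa only [smul_zero] using (inv_smul_le_iff_of_pos hc).1 hinv

theorem exists_neg_mem_nonposCone {b : E} (hb : b ∉ nonposCone u hu) :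
    ∃ (v : E) (hv : 0 < v), v ≤ u ∧ -b ∈ nonposCone v hv.le := by
  have hv : 0 ≤ u ⊓ b⁺ := le_inf hu (posPart_nonneg b)
  have hne : u ⊓ b⁺ ≠ 0 := fun h => hb ((inf_le_inf_left u (le_posPart b)).trans h.le)
  refine ⟨u ⊓ b⁺, hv.lt_of_ne' hne, inf_le_left, ?_⟩
  calc u ⊓ b⁺ ⊓ -b ≤ b⁺ ⊓ b⁻ := inf_le_inf inf_le_right (neg_le_negPart b)
    _ = 0 := posPart_inf_negPart_eq_zero b

theorem IsArchimedean.exists_nsmul_sub_notMem_nonposCone (hE : IsArchimedean E) (hu' : 0 < u)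
    {x : E} {c : ℝ} (hc : 0 ≤ c) (hux : u ≤ c • x) (b : E) :
    ∃ n : ℕ, n • x - b ∉ nonposCone u hu := by
  by_contra! h
  refine hu'.not_ge (hE u |c • b| fun n => sub_nonpos.1 ?_)
  have hmem : c • (n • x - b) ∈ nonposCone u hu :=
    (nonposCone u hu).smul_mem hc (h n)
  have hle : n • u - |c • b| ≤ c • (n • x - b) := by
    rw [smul_sub, smul_comm]
    exact sub_le_sub (nsmul_le_nsmul_right hux n) (le_abs_self _)
  refine nonpos_of_mem_nonposCone (isLowerSet_nonposCone hle hmem) n.cast_add_one_pos ?_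
  calc n • u - |c • b| ≤ n • u := sub_le_self _ (abs_nonneg _)
    _ ≤ (n + 1) • u := nsmul_le_nsmul_left hu n.le_succ
    _ = ((n : ℝ) + 1) • u := by rw [← Nat.cast_smul_eq_nsmul ℝ, Nat.cast_succ]

/-- The density step behind the existence of real homomorphisms: the support of `u` shrinks to one
on which `a` is a multiple of `x` up to `ε • x`. -/
theorem IsArchimedean.exists_abs_sub_smul_mem_nonposCone (hE : IsArchimedean E) (hu' : 0 < u)
    {x : E} (hux : u ≤ x) (a : E) {ε : ℝ} (hε : 0 < ε) :
    ∃ (v : E) (hv : 0 < v), v ≤ u ∧ ∃ q : ℝ, |a - q • x| - ε • x ∈ nonposCone v hv.le := by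
  obtain ⟨n, hn⟩ := hE.exists_nsmul_sub_notMem_nonposCone (hu := hu'.le) hu' zero_le_one
    (hux.trans_eq (one_smul ℝ x).symm) (-a)
  obtain ⟨v₀, hv₀, hv₀u, hlow⟩ := exists_neg_mem_nonposCone hn
  have hv₀x : v₀ ≤ ε⁻¹ • ε • x := by rw [inv_smul_smul₀ hε.ne']; exact hv₀u.trans hux
  -- The grid points `k * ε - n` pass `a` for the first time between `k` and `k + 1`.
  obtain ⟨k, hk, hk'⟩ := Nat.exists_not_and_succ_of_not_zero_of_exists
    (p := fun k => k • ε • x - (n • x + a) ∉ nonposCone v₀ hv₀.le)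
    (by rw [not_not]; convert hlow using 1; rw [zero_nsmul]; abel)
    (hE.exists_nsmul_sub_notMem_nonposCone hv₀ (inv_pos.2 hε).le hv₀x _)
  obtain ⟨v, hv, hvv₀, hupp⟩ := exists_neg_mem_nonposCone hk'
  refine ⟨v, hv, hvv₀.trans hv₀u, (k + 1) * ε - n, ?_⟩
  have hlow' := nonposCone_anti (hv := hv.le) hvv₀ (not_not.1 hk)
  rw [abs, sup_sub]
  refine inf_sup_nonpos (isLowerSet_nonposCone ?_ hupp) ?_
  · convert sub_le_self _ (smul_nonneg hε.le (hu'.le.trans hux)) using 1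
    module
  · refine isLowerSet_nonposCone (le_of_eq ?_) hlow'
    module

end NonposCone
end Archimedean

section Values

variable {E : Type*} [AddCommGroup E] [Lattice E] [IsOrderedAddMonoid E]

theorem abs_sub_le_abs_sub_add (a b c : E) : |a - c| ≤ |a - b| + |b - c| := by
  simpa only [sub_add_sub_cancel] using abs_add_le (a - b) (b - c)

theorem abs_sup_sub_sup_le (a b c d : E) : |a ⊔ b - c ⊔ d| ≤ |a - c| + |b - d| := by
  calc |a ⊔ b - c ⊔ d| ≤ |a ⊔ b - c ⊔ b| + |b ⊔ c - d ⊔ c| := by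
        simpa only [sup_comm c] using abs_sub_le_abs_sub_add (a ⊔ b) (c ⊔ b) (c ⊔ d)
    _ ≤ |a - c| + |b - d| :=
        add_le_add (abs_sup_sub_sup_le_abs a c b) (abs_sup_sub_sup_le_abs b d c)

variable [Module ℝ E]

/-- `a` has the value `r` relative to the unit `x` and a cone `N` of elements regarded as
nonpositive: `|a - r • x| ≤ ε • x` modulo `N` for every `ε > 0`. -/
def HasValue (N : PointedCone ℝ E) (x a : E) (r : ℝ) : Prop :=
  ∀ ε : ℝ, 0 < ε → |a - r • x| - ε • x ∈ N

variable {N : PointedCone ℝ E} {x : E}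

theorem HasValue.of_abs_le (hN : IsLowerSet (N : Set E)) {a b c : E} {r s t : ℝ}
    (ha : HasValue N x a r) (hb : HasValue N x b s)
    (h : |c - t • x| ≤ |a - r • x| + |b - s • x|) : HasValue N x c t := fun ε hε => by
  refine hN ?_ (add_mem (ha _ (half_pos hε)) (hb _ (half_pos hε)))
  rw [sub_add_sub_comm, ← add_smul, add_halves]
  exact sub_le_sub_right h _

theorem HasValue.add (hN : IsLowerSet (N : Set E)) {a b : E} {r s : ℝ} (ha : HasValue N x a r)
    (hb : HasValue N x b s) : HasValue N x (a + b) (r + s) :=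
  ha.of_abs_le hN hb <| by
    rw [add_smul, add_sub_add_comm]
    exact abs_add_le _ _

variable [IsOrderedModule ℝ E]

theorem abs_smul_eq_smul_abs (c : ℝ) (x : E) : |c • x| = |c| • |x| := by
  have key : ∀ {c : ℝ}, 0 < c → |c • x| = c • |x| := fun hc => by
    rw [abs, abs, ← smul_neg]
    exact ((OrderIso.smulRight hc).map_sup x (-x)).symm
  rcases lt_trichotomy c 0 with hc | rfl | hc
  · rw [← abs_neg, ← neg_smul, key (neg_pos.2 hc), abs_of_neg hc]
  · rw [zero_smul, abs_zero, abs_zero, zero_smul]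
  · rw [key hc, abs_of_pos hc]

theorem abs_sub_le_add_of_mem_cone (hN : IsLowerSet (N : Set E)) (hx : 0 ≤ x) (hxN : x ∉ N)
    {a : E} {r s ε δ : ℝ} (hr : |a - r • x| - ε • x ∈ N) (hs : |a - s • x| - δ • x ∈ N) :
    |r - s| ≤ ε + δ := by
  by_contra! h
  have hle : (|r - s| - (ε + δ)) • x ≤ |a - r • x| - ε • x + (|a - s • x| - δ • x) := by
    have htri := abs_sub_le_abs_sub_add (r • x) a (s • x)
    rw [← sub_smul, abs_smul_eq_smul_abs, abs_of_nonneg hx, abs_sub_comm (r • x)] at htri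
    rw [sub_smul, add_smul, sub_add_sub_comm]
    exact sub_le_sub_right htri _
  have hmem := N.smul_mem (inv_pos.2 (sub_pos.2 h)).le (hN hle (add_mem hr hs))
  rw [inv_smul_smul₀ (sub_pos.2 h).ne'] at hmem
  exact hxN hmem

namespace HasValue

theorem unique (hN : IsLowerSet (N : Set E)) (hx : 0 ≤ x) (hxN : x ∉ N) {a : E} {r s : ℝ}
    (hr : HasValue N x a r) (hs : HasValue N x a s) : r = s := by
  refine eq_of_abs_sub_le_all fun ε hε => ?_
  simpa only [add_halves] using
    abs_sub_le_add_of_mem_cone hN hx hxN (hr _ (half_pos hε)) (hs _ (half_pos hε))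

theorem smul_self (hN : IsLowerSet (N : Set E)) (hx : 0 ≤ x) (r : ℝ) :
    HasValue N x (r • x) r := fun ε hε => by
  rw [sub_self, abs_zero, zero_sub]
  exact hN (neg_nonpos.2 (smul_nonneg hε.le hx)) (zero_mem N)

theorem smul (hN : IsLowerSet (N : Set E)) (hx : 0 ≤ x) {a : E} {r : ℝ} (c : ℝ)
    (ha : HasValue N x a r) : HasValue N x (c • a) (c * r) := by
  rcases eq_or_ne c 0 with rfl | hc
  · simpa only [zero_smul, zero_mul] using smul_self hN hx 0
  · intro ε hε
    have hc' := abs_pos.2 hc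
    have h := N.smul_mem hc'.le (ha (ε / |c|) (div_pos hε hc'))
    rwa [smul_sub, smul_smul, mul_div_cancel₀ _ hc'.ne', ← abs_smul_eq_smul_abs, smul_sub,
      smul_smul] at h

theorem sup (hN : IsLowerSet (N : Set E)) (hx : 0 ≤ x) {a b : E} {r s : ℝ}
    (ha : HasValue N x a r) (hb : HasValue N x b s) : HasValue N x (a ⊔ b) (r ⊔ s) :=
  ha.of_abs_le hN hb <| by
    have hmono : Monotone fun r : ℝ => r • x := fun _ _ h => smul_le_smul_of_nonneg_right h hx
    rw [hmono.map_sup r s]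
    exact abs_sup_sub_sup_le a b _ _

theorem inf (hN : IsLowerSet (N : Set E)) (hx : 0 ≤ x) {a b : E} {r s : ℝ}
    (ha : HasValue N x a r) (hb : HasValue N x b s) : HasValue N x (a ⊓ b) (r ⊓ s) := by
  have h := ((ha.smul hN hx (-1)).sup hN hx (hb.smul hN hx (-1))).smul hN hx (-1)
  simpa only [neg_smul, one_smul, neg_mul, one_mul, neg_sup, neg_neg] using h

end HasValue

theorem exists_hasValue (hN : IsLowerSet (N : Set E)) (hx : 0 ≤ x) (hxN : x ∉ N) {a : E}
    (h : ∀ ε : ℝ, 0 < ε → ∃ q : ℝ, |a - q • x| - ε • x ∈ N) : ∃ r, HasValue N x a r := by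
  choose! q hq using h
  obtain ⟨r, hr, hr'⟩ := exists_between_of_forall_le
    (s := (fun ε => q ε - ε) '' Set.Ioi 0) (t := (fun ε => q ε + ε) '' Set.Ioi 0)
    ⟨_, 1, Set.mem_Ioi.2 one_pos, rfl⟩ ⟨_, 1, Set.mem_Ioi.2 one_pos, rfl⟩ <| by
      rintro _ ⟨ε, hε, rfl⟩ _ ⟨δ, hδ, rfl⟩
      have := le_of_abs_le (abs_sub_le_add_of_mem_cone hN hx hxN (hq ε hε) (hq δ hδ))
      linarith
  refine ⟨r, fun ε hε => hN ?_ (hq _ (half_pos hε))⟩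
  have hqr : |q (ε / 2) - r| ≤ ε / 2 :=
    abs_sub_le_iff.2 ⟨by linarith [hr ⟨_, half_pos hε, rfl⟩],
      by linarith [hr' ⟨_, half_pos hε, rfl⟩]⟩
  calc |a - r • x| - ε • x
      ≤ |a - q (ε / 2) • x| + |q (ε / 2) - r| • x - ε • x := by
        refine sub_le_sub_right ?_ _
        rw [← abs_of_nonneg hx, ← abs_smul_eq_smul_abs, sub_smul, abs_of_nonneg hx]
        exact abs_sub_le_abs_sub_add _ _ _
    _ ≤ |a - q (ε / 2) • x| + (ε / 2) • x - ε • x := by gcongr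
    _ = |a - q (ε / 2) • x| - (ε / 2) • x := by module

/-- The vector sublattice of the elements that have a value. -/
def valued (hN : IsLowerSet (N : Set E)) (hx : 0 ≤ x) : VectorSublattice E where
  carrier := {a | ∃ r, HasValue N x a r}
  add_mem' := fun ⟨_, ha⟩ ⟨_, hb⟩ => ⟨_, ha.add hN hb⟩
  zero_mem' := ⟨0, by simpa only [zero_smul] using HasValue.smul_self hN hx 0⟩
  smul_mem' c _ := fun ⟨_, ha⟩ => ⟨_, ha.smul hN hx c⟩
  sup_mem' _ _ := fun ⟨_, ha⟩ ⟨_, hb⟩ => ⟨_, ha.sup hN hx hb⟩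
  inf_mem' _ _ := fun ⟨_, ha⟩ ⟨_, hb⟩ => ⟨_, ha.inf hN hx hb⟩

/-- The real homomorphism that assigns to each valued element its value. -/
noncomputable def valueHom (hN : IsLowerSet (N : Set E)) (hx : 0 ≤ x) (hxN : x ∉ N) :
    VLHom (valued hN hx) ℝ :=
  have unique : ∀ (a : valued hN hx) {r : ℝ}, HasValue N x a r → a.2.choose = r :=
    fun a _ h => a.2.choose_spec.unique hN hx hxN h
  { toFun := fun a => a.2.choose
    map_add' := fun a b => unique _ (a.2.choose_spec.add hN b.2.choose_spec)
    map_smul' := fun c a => unique _ (a.2.choose_spec.smul hN hx c)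
    map_sup' := fun a b => unique _ (a.2.choose_spec.sup hN hx b.2.choose_spec)
    map_inf' := fun a b => unique _ (a.2.choose_spec.inf hN hx b.2.choose_spec) }

theorem valueHom_eq (hN : IsLowerSet (N : Set E)) (hx : 0 ≤ x) (hxN : x ∉ N)
    (a : valued hN hx) {r : ℝ} (h : HasValue N x a r) : valueHom hN hx hxN a = r :=
  a.2.choose_spec.unique hN hx hxN h

end Values

section Separation

variable {E : Type*} [AddCommGroup E] [Lattice E] [Module ℝ E] [IsOrderedAddMonoid E]
  [IsOrderedModule ℝ E]

/-- The Rasiowa–Sikorski argument: an ideal of supports that meets countably many dense sets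
decides the values of countably many elements. -/
theorem IsArchimedean.exists_cone (hE : IsArchimedean E) {A : Set E} (hA : A.Countable) {x : E}
    (hx : 0 < x) :
    ∃ N : PointedCone ℝ E, IsLowerSet (N : Set E) ∧ x ∉ N ∧
      ∀ a ∈ A, ∀ ε : ℝ, 0 < ε → ∃ q : ℝ, |a - q • x| - ε • x ∈ N := by
  have := hA.to_subtype
  let := Encodable.ofCountable (A × ℕ)
  let P := {u : E // 0 < u ∧ u ≤ x}ᵒᵈ
  let cone : P → PointedCone ℝ E := fun u => nonposCone u.1 u.2.1.le
  let decides : A × ℕ → Order.Cofinal P := fun i =>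
    { carrier := {u | ∃ q : ℝ, |i.1.1 - q • x| - (1 / ((i.2 : ℝ) + 1)) • x ∈ cone u}
      isCofinal := fun u => by
        obtain ⟨v, hv, hvu, hq⟩ :=
          hE.exists_abs_sub_smul_mem_nonposCone u.2.1 u.2.2 i.1.1 i.2.one_div_pos_of_nat
        exact ⟨OrderDual.toDual ⟨v, hv, hvu.trans u.2.2⟩, hq, hvu⟩ }
  let J : Order.Ideal P := Order.idealOfCofinals (OrderDual.toDual ⟨x, hx, le_rfl⟩) decides
  have hmem : ∀ {b : E}, b ∈ ⨆ u : J, cone u ↔ ∃ u : J, b ∈ cone u := fun {b} =>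
    haveI : Nonempty J := J.nonempty.to_subtype
    Submodule.mem_iSup_of_directed _ fun u v => by
      obtain ⟨w, hw, huw, hvw⟩ := J.directed u.1 u.2 v.1 v.2
      exact ⟨⟨w, hw⟩, nonposCone_anti huw, nonposCone_anti hvw⟩
  have hlower : IsLowerSet ((⨆ u : J, cone u : PointedCone ℝ E) : Set E) := fun b c hcb hb =>
    hmem.2 <| (hmem.1 hb).imp fun _ h => isLowerSet_nonposCone hcb h
  refine ⟨⨆ u : J, cone u, hlower, fun hxN => ?_, fun a ha ε hε => ?_⟩
  · obtain ⟨u, hu⟩ := hmem.1 hxN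
    exact u.1.2.1.not_ge ((le_inf le_rfl u.1.2.2).trans hu)
  · obtain ⟨n, hn⟩ := exists_nat_one_div_lt hε
    obtain ⟨u, ⟨q, hq⟩, huJ⟩ := Order.cofinal_meets_idealOfCofinals
      (OrderDual.toDual ⟨x, hx, le_rfl⟩) decides (⟨a, ha⟩, n)
    refine ⟨q, hlower ?_ (hmem.2 ⟨⟨u, huJ⟩, hq⟩)⟩
    exact sub_le_sub_left (smul_le_smul_of_nonneg_right hn.le hx.le) _

theorem IsArchimedean.exists_sublattice_hom (hE : IsArchimedean E) {A : Set E}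
    (hA : A.Countable) {x : E} (hx : 0 < x) :
    ∃ (L : VectorSublattice E) (hxL : x ∈ L) (ω : VLHom L ℝ), A ⊆ L ∧ ω ⟨x, hxL⟩ = 1 := by
  obtain ⟨N, hN, hxN, hA⟩ := hE.exists_cone hA hx
  have hone : HasValue N x x 1 := by
    simpa only [one_smul] using HasValue.smul_self hN hx.le 1
  exact ⟨valued hN hx.le, ⟨1, hone⟩, valueHom hN hx.le hxN,
    fun a ha => exists_hasValue hN hx.le hxN (hA a ha), valueHom_eq hN hx.le hxN ⟨x, _⟩ hone⟩

open VectorSublattice in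
theorem IsArchimedean.nonneg_of_forall_hom (hE : IsArchimedean E) {A : Set E}
    (hA : A.Countable) {y : closure A} (h : ∀ ω : VLHom (closure A) ℝ, 0 ≤ ω y) : 0 ≤ y := by
  by_contra hy
  have hneg : 0 < (y : E)⁻ :=
    (negPart_nonneg _).lt_of_ne' fun h0 => hy (negPart_eq_zero (a := (y : E)) |>.1 h0)
  obtain ⟨L, hL, ω, hAL, hω⟩ := hE.exists_sublattice_hom hA hneg
  have hyL : (y : E) ∈ L := closure_le hAL y.2
  have hωy : 0 ≤ ω ⟨y, hyL⟩ := h (ω.comp (inclusion (closure_le hAL)))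
  have hsup : (⟨(y : E)⁻, hL⟩ : L) = (-⟨y, hyL⟩) ⊔ 0 := rfl
  rw [hsup, map_sup, map_neg, map_zero, sup_eq_right.2 (neg_nonpos.2 hωy)] at hω
  exact zero_ne_one hω

theorem IsArchimedean.le_of_forall_hom (hE : IsArchimedean E) {A : Set E} (hA : A.Countable)
    {y z : VectorSublattice.closure A}
    (h : ∀ ω : VLHom (VectorSublattice.closure A) ℝ, ω y ≤ ω z) : y ≤ z :=
  sub_nonneg.1 <| hE.nonneg_of_forall_hom hA fun ω => by
    rw [map_sub]
    exact sub_nonneg.2 (h ω)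

theorem IsArchimedean.eq_of_forall_hom (hE : IsArchimedean E) {A : Set E} (hA : A.Countable)
    {y z : VectorSublattice.closure A}
    (h : ∀ ω : VLHom (VectorSublattice.closure A) ℝ, ω y = ω z) : y = z :=
  le_antisymm (hE.le_of_forall_hom hA fun ω => (h ω).le)
    (hE.le_of_forall_hom hA fun ω => (h ω).ge)

end Separation

section RelativelyUniform

variable {E F : Type*} [AddCommGroup E] [Lattice E] [Module ℝ E]
  [AddCommGroup F] [Lattice F] [Module ℝ F]

/-- Relatively uniform convergence with regulator `p`; the weak inequality also admits `p = 0`. -/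
def RUBy (p : E) (f : ℕ → E) (g : E) : Prop :=
  ∀ ε : ℝ, 0 < ε → ∃ N : ℕ, ∀ n, N ≤ n → |f n - g| ≤ ε • p

/-- The relatively uniform Cauchy property with regulator `p`. -/
def RUCauchyBy (p : E) (f : ℕ → E) : Prop :=
  ∀ ε : ℝ, 0 < ε → ∃ N : ℕ, ∀ m n, N ≤ m → N ≤ n → |f m - f n| ≤ ε • p

theorem RUConverges.exists_ruBy {f : ℕ → E} {g : E} (h : RUConverges f g) :
    ∃ p, RUBy p f g := by
  obtain ⟨p, -, hp⟩ := h
  exact ⟨p, fun ε hε => (hp ε hε).imp fun N hN n hn => (hN n hn).le⟩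

theorem RUCauchy.exists_ruCauchyBy {f : ℕ → E} (h : RUCauchy f) :
    ∃ p, 0 < p ∧ RUCauchyBy p f := by
  obtain ⟨p, hp, h⟩ := h
  exact ⟨p, hp, fun ε hε => (h ε hε).imp fun N hN m n hm hn => (hN m n hm hn).le⟩

theorem RUBy.map {p : E} {f : ℕ → E} {g : E} (T : VLHom E F) (hf : RUBy p f g) :
    RUBy (T p) (fun n => T (f n)) (T g) := fun ε hε =>
  (hf ε hε).imp fun N hN n hn => by
    rw [← map_sub, ← T.map_abs, ← map_smul]
    exact OrderHomClass.mono T (hN n hn)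

variable [IsOrderedAddMonoid E]

theorem RUBy.ruCauchyBy {p : E} {f : ℕ → E} {g : E} (hf : RUBy p f g) : RUCauchyBy p f :=
  fun ε hε => (hf (ε / 2) (half_pos hε)).imp fun N hN m n hm hn => by
    calc |f m - f n| ≤ |f m - g| + |f n - g| := by
          simpa only [abs_sub_comm g] using abs_sub_le_abs_sub_add (f m) g (f n)
      _ ≤ (ε / 2) • p + (ε / 2) • p := add_le_add (hN m hm) (hN n hn)
      _ = ε • p := by rw [← add_smul, add_halves]

theorem RUCauchyBy.regulator_nonneg {p : E} {f : ℕ → E} (hf : RUCauchyBy p f) : 0 ≤ p := by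
  obtain ⟨N, hN⟩ := hf 1 one_pos
  simpa only [sub_self, abs_zero, one_smul] using hN N N le_rfl le_rfl

variable [IsOrderedModule ℝ E]

theorem smul_lt_smul_right_of_pos {p : E} (hp : 0 < p) {ε δ : ℝ} (h : ε < δ) :
    ε • p < δ • p := by
  rw [← sub_pos, ← sub_smul]
  exact (smul_nonneg (sub_pos.2 h).le hp.le).lt_of_ne'
    (smul_ne_zero (sub_pos.2 h).ne' hp.ne')

theorem RUBy.ruConverges {p : E} (hp : 0 < p) {f : ℕ → E} {g : E} (h : RUBy p f g) :
    RUConverges f g :=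
  ⟨p, hp, fun ε hε => (h (ε / 2) (half_pos hε)).imp fun _ hN n hn =>
    (hN n hn).trans_lt (smul_lt_smul_right_of_pos hp (half_lt_self hε))⟩

theorem RUCauchyBy.ruCauchy {p : E} (hp : 0 < p) {f : ℕ → E} (h : RUCauchyBy p f) :
    RUCauchy f :=
  ⟨p, hp, fun ε hε => (h (ε / 2) (half_pos hε)).imp fun _ hN m n hm hn =>
    (hN m n hm hn).trans_lt (smul_lt_smul_right_of_pos hp (half_lt_self hε))⟩

theorem IsArchimedean.eq_of_ruBy (hE : IsArchimedean E) {p q : E} {f : ℕ → E} {g g' : E}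
    (h : RUBy p f g) (h' : RUBy q f g') : g = g' := by
  have hle : |g - g'| ≤ 0 := hE.nonpos_of_forall_le_smul (p := p + q) fun ε hε => by
    obtain ⟨N, hN⟩ := h ε hε
    obtain ⟨M, hM⟩ := h' ε hε
    calc |g - g'| ≤ |f (max N M) - g| + |f (max N M) - g'| := by
          simpa only [abs_sub_comm g] using abs_sub_le_abs_sub_add g (f (max N M)) g'
      _ ≤ ε • p + ε • q := add_le_add (hN _ (le_max_left N M)) (hM _ (le_max_right N M))
      _ = ε • (p + q) := (smul_add ε p q).symm
  exact le_antisymm (sub_nonpos.1 ((le_abs_self _).trans hle))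
    (sub_nonneg.1 (neg_nonpos.1 ((neg_le_abs _).trans hle)))

theorem RUCauchyBy.ruBy (hE : IsArchimedean E) {p q : E} {f : ℕ → E} {g : E}
    (hf : RUCauchyBy p f) (hg : RUBy q f g) : RUBy p f g := by
  intro ε hε
  obtain ⟨N, hN⟩ := hf ε hε
  refine ⟨N, fun n hn => hE.le_of_forall_le_add_smul (p := q) fun δ hδ => ?_⟩
  obtain ⟨M, hM⟩ := hg δ hδ
  exact (abs_sub_le_abs_sub_add (f n) (f (max N M)) g).trans
    (add_le_add (hN n _ hn (le_max_left N M)) (hM _ (le_max_right N M)))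

theorem UniformlyComplete.exists_ruBy (hE : IsArchimedean E) (hc : UniformlyComplete E) {p : E}
    {f : ℕ → E} (hf : RUCauchyBy p f) : ∃ g, RUBy p f g := by
  rcases hf.regulator_nonneg.eq_or_lt with rfl | hp
  · obtain ⟨N, hN⟩ := hf 1 one_pos
    exact ⟨f N, fun ε _ => ⟨N, fun n hn => by
      simpa only [smul_zero] using hN n N hn le_rfl⟩⟩
  · obtain ⟨g, hg⟩ := hc f (hf.ruCauchy hp)
    obtain ⟨q, hq⟩ := hg.exists_ruBy
    exact ⟨g, hf.ruBy hE hq⟩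

end RelativelyUniform

namespace VectorSublattice

section RUClosed

variable {E F : Type*} [AddCommGroup E] [Lattice E] [Module ℝ E]
  [AddCommGroup F] [Lattice F] [Module ℝ F]

/-- Closedness under relatively uniform limits whose regulator lies in the sublattice. -/
def RUClosed (L : VectorSublattice E) : Prop :=
  ∀ (f : ℕ → E) (p g : E), (∀ n, f n ∈ L) → p ∈ L → RUBy p f g → g ∈ L

/-- The smallest relatively uniformly closed vector sublattice that contains a given set. -/
def ruClosure (A : Set E) : VectorSublattice E where
  carrier := {x | ∀ L : VectorSublattice E, L.RUClosed → A ⊆ L → x ∈ L}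
  add_mem' hx hy L hc hL := add_mem (hx L hc hL) (hy L hc hL)
  zero_mem' L _ _ := zero_mem L
  smul_mem' c _ hx L hc hL := L.smul_mem c (hx L hc hL)
  sup_mem' _ _ hx hy L hc hL := L.sup_mem (hx L hc hL) (hy L hc hL)
  inf_mem' _ _ hx hy L hc hL := L.inf_mem (hx L hc hL) (hy L hc hL)

theorem subset_ruClosure (A : Set E) : A ⊆ ruClosure A := fun _ hx _ _ hL => hL hx

theorem ruClosed_ruClosure (A : Set E) : (ruClosure A).RUClosed :=
  fun f p g hf hp h L hc hL => hc f p g (fun n => hf n L hc hL) (hp L hc hL) h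

theorem ruClosure_le {A : Set E} {L : VectorSublattice E} (hL : L.RUClosed) (h : A ⊆ L) :
    (ruClosure A : Set E) ⊆ L := fun _ hx => hx L hL h

theorem RUClosed.comap (T : VLHom E F) {L : VectorSublattice F} (hL : L.RUClosed) :
    (comap T L).RUClosed := fun _ _ _ hf hp h => hL _ _ _ hf hp (h.map T)

theorem RUClosed.map_subtype {L : VectorSublattice E} (hL : L.RUClosed)
    {M : VectorSublattice L} (hM : M.RUClosed) : (map L.subtype M).RUClosed := by
  intro f p g hf hp h
  choose f' hf' hff using fun n => mem_map.1 (hf n)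
  obtain ⟨p', hp', rfl⟩ := mem_map.1 hp
  obtain rfl : (fun n => L.subtype (f' n)) = f := funext hff
  have hg : g ∈ L := hL _ _ g (fun n => (f' n).2) p'.2 h
  exact mem_map.2 ⟨⟨g, hg⟩, hM f' p' ⟨g, hg⟩ hf' hp' h, rfl⟩

variable [IsOrderedAddMonoid E] [IsOrderedModule ℝ E]

theorem RUClosed.uniformlyComplete {L : VectorSublattice E} (hL : L.RUClosed)
    (hE : IsArchimedean E) (hc : UniformlyComplete E) : UniformlyComplete L := by
  intro f hf
  obtain ⟨p, hp, hf⟩ := hf.exists_ruCauchyBy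
  obtain ⟨g, hg⟩ := hc.exists_ruBy hE (p := (p : E)) (f := fun n => (f n : E)) hf
  have hgL : g ∈ L := hL _ _ g (fun n => (f n).2) p.2 hg
  exact ⟨⟨g, hgL⟩, RUBy.ruConverges hp (g := ⟨g, hgL⟩) hg⟩

variable [IsOrderedAddMonoid F] [IsOrderedModule ℝ F]

theorem ruClosed_range (hE : IsArchimedean E) (hc : UniformlyComplete E) (hF : IsArchimedean F)
    (T : VLHom E F) (hT : Function.Injective T) : T.range.RUClosed := by
  intro f p g hf hp h
  choose f' hf' using hf
  obtain ⟨p', rfl⟩ := hp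
  obtain rfl : (fun n => T (f' n)) = f := funext hf'
  have hcauchy : RUCauchyBy p' f' := fun ε hε =>
    (h.ruCauchyBy ε hε).imp fun N hN m n hm hn => by
      rw [← T.le_iff_le_of_injective hT, T.map_abs, map_sub, map_smul]
      exact hN m n hm hn
  obtain ⟨g', hg'⟩ := hc.exists_ruBy hE hcauchy
  exact ⟨g', hF.eq_of_ruBy (hg'.map T) h⟩

end RUClosed

section EqLocus

variable {E F : Type*} [AddCommGroup E] [Lattice E] [Module ℝ E]
  [AddCommGroup F] [Lattice F] [Module ℝ F] [IsOrderedAddMonoid F] [IsOrderedModule ℝ F]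

theorem ruClosed_eqLocus (hF : IsArchimedean F) (S T : VLHom E F) : (eqLocus S T).RUClosed := by
  intro f p g hf _ h
  have hST : (fun n => T (f n)) = fun n => S (f n) := funext fun n => (hf n).symm
  exact hF.eq_of_ruBy (h.map S) (hST ▸ h.map T)

theorem eq_of_eqOn_ruClosure (hF : IsArchimedean F) {A : Set E} {S T : VLHom (ruClosure A) F}
    (h : ∀ (x : E) (hx : x ∈ A), S ⟨x, subset_ruClosure A hx⟩ = T ⟨x, subset_ruClosure A hx⟩) :
    S = T := by
  have hclosed := (ruClosed_ruClosure A).map_subtype (ruClosed_eqLocus hF S T)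
  refine VLHom.ext fun x => ?_
  obtain ⟨y, hy, hyx⟩ := mem_map.1 <| ruClosure_le hclosed
    (fun z hz => mem_map.2 ⟨⟨z, subset_ruClosure A hz⟩, h z hz, rfl⟩) x.2
  obtain rfl : y = x := Subtype.ext hyx
  exact hy

end EqLocus

end VectorSublattice

section Germs

open Filter

variable {X Y : Type*} {l : Filter X} {l' : Filter Y}

instance instIsOrderedModuleGerm : IsOrderedModule ℝ (Germ l ℝ) where
  smul_le_smul_of_nonneg_left c hc x y h := by
    induction x, y using Germ.inductionOn₂ with
    | _ f g => exact (Germ.coe_le.1 h).mono fun _ h => mul_le_mul_of_nonneg_left h hc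
  smul_le_smul_of_nonneg_right x hx c d h := by
    induction x using Germ.inductionOn with
    | _ f => exact (Germ.coe_le.1 hx).mono fun _ hx => mul_le_mul_of_nonneg_right h hx

/-- Composition of germs with a function, as a vector lattice homomorphism. -/
def germCompTendsto (τ : Y → X) (hτ : Tendsto τ l' l) : VLHom (Germ l ℝ) (Germ l' ℝ) where
  toFun x := x.compTendsto τ hτ
  map_add' x y := Germ.inductionOn₂ x y fun _ _ => rfl
  map_smul' _ x := Germ.inductionOn x fun _ => rfl
  map_sup' x y := Germ.inductionOn₂ x y fun _ _ => rfl
  map_inf' x y := Germ.inductionOn₂ x y fun _ _ => rfl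

theorem exists_real_limit {f : ℕ → ℝ} {p : ℝ} {N : ℕ → ℕ}
    (h : ∀ k m n, N k ≤ m → N k ≤ n → |f m - f n| ≤ 1 / ((k : ℝ) + 1) * p) :
    ∃ g, ∀ k n, N k ≤ n → |f n - g| ≤ 1 / ((k : ℝ) + 1) * p := by
  have hp : Tendsto (fun k : ℕ => 1 / ((k : ℝ) + 1) * p) atTop (nhds 0) := by
    simpa only [zero_mul] using tendsto_one_div_add_atTop_nhds_zero_nat.mul_const p
  have hcauchy : CauchySeq f := Metric.cauchySeq_iff.2 fun ε hε => by
    obtain ⟨k, hk⟩ := (hp.eventually_lt_const hε).exists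
    exact ⟨N k, fun m hm n hn => (h k m n hm hn).trans_lt hk⟩
  obtain ⟨g, hg⟩ := cauchySeq_tendsto_of_complete hcauchy
  exact ⟨g, fun k n hn => le_of_tendsto (hg.const_sub (f n)).abs
    ((eventually_ge_atTop (N k)).mono fun m hm => h k n m hn hm)⟩

variable [CountableInterFilter l]

theorem isArchimedean_germ : IsArchimedean (Germ l ℝ) := by
  intro x y h
  induction x, y using Germ.inductionOn₂ with
  | _ f g =>
    have h' : ∀ᶠ t in l, ∀ n : ℕ, n • f t ≤ g t :=
      eventually_countable_forall.2 fun n => Germ.coe_le.1 (h n)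
    refine Germ.coe_le.2 (h'.mono fun t ht => isArchimedean_real (f t) (g t) ht)

theorem uniformlyComplete_germ : UniformlyComplete (Germ l ℝ) := by
  intro F hF
  obtain ⟨q, hq, hF⟩ := hF.exists_ruCauchyBy
  choose f hf using fun n => Quotient.exists_rep (F n)
  obtain rfl : (fun n => (f n : Germ l ℝ)) = F := funext hf
  induction q using Germ.inductionOn with
  | _ p =>
  choose N hN using fun k : ℕ => hF (1 / ((k : ℝ) + 1)) Nat.one_div_pos_of_nat
  have hev : ∀ᶠ t in l, ∀ k m n : ℕ, N k ≤ m → N k ≤ n →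
      |f m t - f n t| ≤ 1 / ((k : ℝ) + 1) * p t := by
    simp only [eventually_countable_forall]
    exact fun k m n hm hn => Germ.coe_le.1 (hN k m n hm hn)
  choose! g hg using fun (t : X) (ht : ∀ k m n : ℕ, N k ≤ m → N k ≤ n →
      |f m t - f n t| ≤ 1 / ((k : ℝ) + 1) * p t) => exists_real_limit ht
  refine ⟨(g : Germ l ℝ), RUBy.ruConverges hq fun ε hε => ?_⟩
  obtain ⟨k, hk⟩ := exists_nat_one_div_lt hε
  refine ⟨N k, fun n hn => le_trans ?_ (smul_le_smul_of_nonneg_right hk.le hq.le)⟩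
  exact Germ.coe_le.2 (hev.mono fun t ht => hg t ht k n hn)

end Germs

section Embedding

open Filter VectorSublattice

variable {E F : Type*} [AddCommGroup E] [Lattice E] [Module ℝ E]
  [AddCommGroup F] [Lattice F] [Module ℝ F]

/-- The real functions on `E` that restrict to a homomorphism on the vector sublattice
generated by `A`. -/
def homOn (A : Set E) : Set (E → ℝ) :=
  {ω | ∃ T : VLHom (closure A) ℝ, ∀ x : closure A, ω x = T x}

theorem homOn_anti {A B : Set E} (h : A ⊆ B) : homOn B ⊆ homOn A := fun _ ⟨T, hT⟩ =>
  ⟨T.comp (inclusion (closure_mono h)), fun x => hT (inclusion (closure_mono h) x)⟩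

theorem comp_mem_homOn (T : VLHom E F) {A : Set E} {ω : F → ℝ} (hω : ω ∈ homOn (T '' A)) :
    ω ∘ T ∈ homOn A := by
  obtain ⟨S, hS⟩ := hω
  have hT : (closure A : Set E) ⊆ comap T (closure (T '' A)) :=
    closure_le fun x hx => subset_closure _ (Set.mem_image_of_mem T hx)
  exact ⟨S.comp ((T.comp (closure A).subtype).codRestrict _ fun x => hT x.2),
    fun x => hS ⟨T x, hT x.2⟩⟩

variable (E) in
/-- The filter generated by the sets of functions that are homomorphisms on a countably generated
vector sublattice. In general no real homomorphism is defined on all of `E`; this filter replaces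
the missing representation space. -/
def homFilter : Filter (E → ℝ) :=
  Filter.ofCountableInter {s | ∃ A : Set E, A.Countable ∧ homOn A ⊆ s}
    (fun S hS h => by
      choose! A hA hAS using fun s (hs : s ∈ S) => h hs
      exact ⟨⋃ s ∈ S, A s, hS.biUnion fun s hs => hA s hs, fun ω hω s hs =>
        hAS s hs (homOn_anti (Set.subset_biUnion_of_mem hs) hω)⟩)
    (fun _ _ ⟨A, hA, h⟩ hst => ⟨A, hA, h.trans hst⟩)

instance instCountableInterFilterHomFilter : CountableInterFilter (homFilter E) := by
  unfold homFilter
  infer_instance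

theorem tendsto_comp_homFilter (T : VLHom E F) :
    Tendsto (fun ω : F → ℝ => ω ∘ T) (homFilter F) (homFilter E) := fun _ ⟨A, hA, hAs⟩ =>
  ⟨T '' A, hA.image T, fun _ hω => hAs (comp_mem_homOn T hω)⟩

theorem eventually_exists_hom (x y : E) :
    ∀ᶠ ω in homFilter E, ∃ T : VLHom (closure {x, y}) ℝ, ∀ z : closure {x, y}, ω z = T z :=
  ⟨{x, y}, (Set.countable_singleton y).insert x, fun _ h => h⟩

variable (E) in
/-- Evaluation, as a homomorphism into a space of germs of real functions. -/
def evalGerm : VLHom E (Germ (homFilter E) ℝ) :=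
  have left : ∀ x y : E, x ∈ closure {x, y} := fun x y => subset_closure _ (Or.inl rfl)
  have right : ∀ x y : E, y ∈ closure {x, y} := fun x y => subset_closure _ (Or.inr rfl)
  { toFun := fun x => ((fun ω => ω x : (E → ℝ) → ℝ) : Germ (homFilter E) ℝ)
    map_add' := fun x y => Germ.coe_eq.2 <| (eventually_exists_hom x y).mono fun ω ⟨T, hT⟩ => by
      have h := map_add T ⟨x, left x y⟩ ⟨y, right x y⟩
      rwa [← hT, ← hT, ← hT] at h
    map_smul' := fun c x => Germ.coe_eq.2 <| (eventually_exists_hom x x).mono fun ω ⟨T, hT⟩ => by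
      have h := map_smul T c ⟨x, left x x⟩
      rwa [← hT, ← hT] at h
    map_sup' := fun x y => Germ.coe_eq.2 <| (eventually_exists_hom x y).mono fun ω ⟨T, hT⟩ => by
      have h : T (⟨x, left x y⟩ ⊔ ⟨y, right x y⟩) = _ := map_sup T _ _
      rwa [← hT, ← hT, ← hT] at h
    map_inf' := fun x y => Germ.coe_eq.2 <| (eventually_exists_hom x y).mono fun ω ⟨T, hT⟩ => by
      have h : T (⟨x, left x y⟩ ⊓ ⟨y, right x y⟩) = _ := map_inf T _ _
      rwa [← hT, ← hT, ← hT] at h }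

/-- The action of a vector lattice homomorphism on the spaces of germs. -/
def germMap (T : VLHom E F) : VLHom (Germ (homFilter E) ℝ) (Germ (homFilter F) ℝ) :=
  germCompTendsto (fun ω => ω ∘ T) (tendsto_comp_homFilter T)

theorem germMap_evalGerm (T : VLHom E F) (x : E) :
    germMap T (evalGerm E x) = evalGerm F (T x) := rfl

theorem IsArchimedean.evalGerm_injective [IsOrderedAddMonoid E] [IsOrderedModule ℝ E]
    (hE : IsArchimedean E) : Function.Injective (evalGerm E) := by
  intro x y hxy
  obtain ⟨A, hA, hAxy⟩ : ∀ᶠ ω : E → ℝ in homFilter E, ω x = ω y := Germ.coe_eq.1 hxy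
  have hx : x ∈ closure (A ∪ {x, y}) := subset_closure _ (Or.inr (Or.inl rfl))
  have hy : y ∈ closure (A ∪ {x, y}) := subset_closure _ (Or.inr (Or.inr rfl))
  have heq : (⟨x, hx⟩ : closure (A ∪ {x, y})) = ⟨y, hy⟩ :=
    hE.eq_of_forall_hom (hA.union ((Set.countable_singleton y).insert x)) fun T => by
      let ω : E → ℝ := Function.extend Subtype.val T 0
      have hω : ∀ z : closure (A ∪ {x, y}), ω z = T z := Subtype.val_injective.extend_apply T 0
      have hωxy : ω x = ω y := hAxy (homOn_anti Set.subset_union_left ⟨T, hω⟩)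
      rwa [← hω, ← hω]
  exact congrArg Subtype.val heq

end Embedding

section UniformCompletion

open VectorSublattice

variable {E : Type u} [AddCommGroup E] [Lattice E] [Module ℝ E]
  {F : Type v} [AddCommGroup F] [Lattice F] [Module ℝ F] [IsOrderedAddMonoid F]
  [IsOrderedModule ℝ F]

variable (E) in
/-- The uniform completion of `E`, as the relatively uniform closure of `E` in the germs of real
functions along `homFilter E`. -/
def uniformCompletion : VectorSublattice (Filter.Germ (homFilter E) ℝ) :=
  ruClosure (Set.range (evalGerm E))

variable (E) in
/-- The natural map of `E` into its uniform completion. -/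
def toUniformCompletion : VLHom E (uniformCompletion E) :=
  (evalGerm E).codRestrict _ fun x => subset_ruClosure _ ⟨x, rfl⟩

variable (E) in
theorem isArchimedean_uniformCompletion : IsArchimedean (uniformCompletion E) :=
  (uniformCompletion E).isArchimedean isArchimedean_germ

variable (E) in
theorem uniformlyComplete_uniformCompletion : UniformlyComplete (uniformCompletion E) :=
  (ruClosed_ruClosure _).uniformlyComplete isArchimedean_germ uniformlyComplete_germ

theorem germMap_mem_range_evalGerm (hF : IsArchimedean F) (hc : UniformlyComplete F)
    (T : VLHom E F) (x : uniformCompletion E) : germMap T x ∈ (evalGerm F).range := by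
  have hclosed : (comap (germMap T) (evalGerm F).range).RUClosed :=
    (ruClosed_range hF hc isArchimedean_germ _ hF.evalGerm_injective).comap _
  refine ruClosure_le hclosed ?_ x.2
  rintro _ ⟨y, rfl⟩
  exact ⟨T y, rfl⟩

theorem existsUnique_extension_uniformCompletion (hF : IsArchimedean F) (hc : UniformlyComplete F)
    (T : VLHom E F) :
    ∃! S : VLHom (uniformCompletion E) F, ∀ x, S (toUniformCompletion E x) = T x := by
  have hinj := hF.evalGerm_injective
  let S : VLHom (uniformCompletion E) F :=
    VLHom.lift (evalGerm F) hinj ((germMap T).comp (uniformCompletion E).subtype)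
      (germMap_mem_range_evalGerm hF hc T)
  have hS : ∀ x, S (toUniformCompletion E x) = T x := fun x => hinj (VLHom.apply_lift _ _ _ _ _)
  refine ⟨S, hS, fun S' hS' => eq_of_eqOn_ruClosure hF ?_⟩
  rintro _ ⟨x, rfl⟩
  exact (hS' x).trans (hS x).symm

theorem IsArchimedean.isUniformCompletion [IsOrderedAddMonoid E] [IsOrderedModule ℝ E]
    (hE : IsArchimedean E) : IsUniformCompletion.{u, u, w} (toUniformCompletion E) where
  archimedean := isArchimedean_uniformCompletion E
  uniformlyComplete := uniformlyComplete_uniformCompletion E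
  injective _ _ h := hE.evalGerm_injective (congrArg Subtype.val h)
  universal _ _ _ _ _ _ hF hc T := existsUnique_extension_uniformCompletion hF hc T

end UniformCompletion

section LatticeLinear

/-- Positive homogeneity of a real function. -/
def PosHomogeneous {V : Type*} [SMul ℝ V] (f : V → ℝ) : Prop :=
  ∀ (c : ℝ) (x : V), 0 ≤ c → f (c • x) = c * f x

theorem PosHomogeneous.map_zero {V : Type*} [AddCommGroup V] [Module ℝ V] {f : V → ℝ}
    (hf : PosHomogeneous f) : f 0 = 0 := by
  simpa only [zero_smul, zero_mul] using hf 0 0 le_rfl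

theorem PosHomogeneous.abs_sub_le_mul_norm {V : Type*} [NormedAddCommGroup V] [NormedSpace ℝ V]
    {f g : V → ℝ} (hf : PosHomogeneous f) (hg : PosHomogeneous g) {ε : ℝ}
    (h : ∀ x, ‖x‖ = 1 → |f x - g x| ≤ ε) (x : V) : |f x - g x| ≤ ε * ‖x‖ := by
  rcases eq_or_ne x 0 with rfl | hx
  · rw [hf.map_zero, hg.map_zero, sub_self, abs_zero, norm_zero, mul_zero]
  · obtain ⟨u, hu, hxu⟩ : ∃ u : V, ‖u‖ = 1 ∧ ‖x‖ • u = x :=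
      ⟨‖x‖⁻¹ • x, norm_smul_inv_norm hx, smul_inv_smul₀ (norm_ne_zero_iff.2 hx) x⟩
    calc |f x - g x| = ‖x‖ * |f u - g u| := by
          rw [← congrArg f hxu, ← congrArg g hxu, hf _ u (norm_nonneg x),
            hg _ u (norm_nonneg x), ← mul_sub, abs_mul, abs_norm]
      _ ≤ ‖x‖ * ε := mul_le_mul_of_nonneg_left (h u hu) (norm_nonneg x)
      _ = ε * ‖x‖ := mul_comm _ _

section Topological

variable (V : Type*) [AddCommGroup V] [Module ℝ V] [TopologicalSpace V]

/-- The vector lattice of functions on `V` generated by the continuous linear functionals. -/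
def latticeLinear : VectorSublattice (V → ℝ) :=
  VectorSublattice.closure (Set.range fun f : V →L[ℝ] ℝ => ⇑f)

variable {V}

theorem coe_mem_latticeLinear (f : V →L[ℝ] ℝ) : ⇑f ∈ latticeLinear V :=
  VectorSublattice.subset_closure _ ⟨f, rfl⟩

theorem continuous_of_mem_latticeLinear {g : V → ℝ} (hg : g ∈ latticeLinear V) :
    Continuous g :=
  hg { carrier := {g | Continuous g}
       add_mem' := fun hf hg => hf.add hg
       zero_mem' := continuous_const
       smul_mem' := fun c _ hf => hf.const_smul c
       sup_mem' := fun _ _ hf hg => hf.sup hg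
       inf_mem' := fun _ _ hf hg => hf.inf hg } <| by
    rintro _ ⟨f, rfl⟩
    exact f.continuous

theorem posHomogeneous_of_mem_latticeLinear {g : V → ℝ} (hg : g ∈ latticeLinear V) :
    PosHomogeneous g :=
  hg { carrier := {g | PosHomogeneous g}
       add_mem' := fun hf hg c x hc => by
        rw [Pi.add_apply, Pi.add_apply, hf c x hc, hg c x hc, mul_add]
       zero_mem' := fun c _ _ => (mul_zero c).symm
       smul_mem' := fun r _ hf c x hc => by
        rw [Pi.smul_apply, Pi.smul_apply, hf c x hc, smul_eq_mul, smul_eq_mul, mul_left_comm]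
       sup_mem' := fun _ _ hf hg c x hc => by
        rw [Pi.sup_apply, Pi.sup_apply, hf c x hc, hg c x hc, mul_max_of_nonneg _ _ hc]
       inf_mem' := fun _ _ hf hg c x hc => by
        rw [Pi.inf_apply, Pi.inf_apply, hf c x hc, hg c x hc, mul_min_of_nonneg _ _ hc] } <| by
    rintro _ ⟨f, rfl⟩ c x -
    exact f.map_smul c x

end Topological

section Approximation

variable {V : Type*} [NormedAddCommGroup V] [InnerProductSpace ℝ V]

theorem exists_latticeLinear_separating {x y : V} (hx : ‖x‖ = 1) (hy : ‖y‖ = 1) (hxy : x ≠ y) :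
    ∃ g ∈ latticeLinear V, g x = 1 ∧ g y = 0 := by
  have hpos : 0 < 1 - inner ℝ x y :=
    sub_pos.2 ((inner_lt_one_iff_real_of_norm_eq_one hx hy).2 hxy)
  have hfx : innerSL ℝ (x - y) x = 1 - inner ℝ x y := by
    rw [innerSL_apply_apply, inner_sub_left, inner_self_eq_one_of_norm_eq_one hx,
      real_inner_comm]
  have hfy : innerSL ℝ (x - y) y = -(1 - inner ℝ x y) := by
    rw [innerSL_apply_apply, inner_sub_left, inner_self_eq_one_of_norm_eq_one hy, neg_sub]
  refine ⟨(1 - inner ℝ x y)⁻¹ • (⇑(innerSL ℝ (x - y)) ⊔ 0), (latticeLinear V).smul_mem _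
    ((latticeLinear V).sup_mem (coe_mem_latticeLinear _) (zero_mem _)), ?_, ?_⟩
  · rw [Pi.smul_apply, Pi.sup_apply, hfx, Pi.zero_apply, sup_eq_left.2 hpos.le, smul_eq_mul,
      inv_mul_cancel₀ hpos.ne']
  · rw [Pi.smul_apply, Pi.sup_apply, hfy, Pi.zero_apply, sup_eq_right.2 (neg_nonpos.2 hpos.le),
      smul_zero]

theorem exists_latticeLinear_interpolating (v : Metric.sphere (0 : V) 1 → ℝ)
    (x y : Metric.sphere (0 : V) 1) : ∃ g ∈ latticeLinear V, g x = v x ∧ g y = v y := by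
  have hx := norm_eq_of_mem_sphere x
  have hy := norm_eq_of_mem_sphere y
  rcases eq_or_ne x y with rfl | hxy
  · have h : (v x • innerSL ℝ (x : V)) x = v x := by
      rw [smul_apply, innerSL_apply_apply,
        inner_self_eq_one_of_norm_eq_one hx, smul_eq_mul, mul_one]
    exact ⟨_, coe_mem_latticeLinear (v x • innerSL ℝ (x : V)), h, h⟩
  · have hxy' := Subtype.coe_injective.ne hxy
    obtain ⟨f, hf, hfx, hfy⟩ := exists_latticeLinear_separating hx hy hxy'
    obtain ⟨g, hg, hgy, hgx⟩ := exists_latticeLinear_separating hy hx hxy'.symm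
    refine ⟨v x • f + v y • g, add_mem ((latticeLinear V).smul_mem _ hf)
      ((latticeLinear V).smul_mem _ hg), ?_, ?_⟩
    · simp only [Pi.add_apply, Pi.smul_apply, hfx, hgx, smul_eq_mul, mul_one, mul_zero, add_zero]
    · simp only [Pi.add_apply, Pi.smul_apply, hfy, hgy, smul_eq_mul, mul_one, mul_zero, zero_add]

variable [ProperSpace V]

theorem exists_latticeLinear_approx_on_sphere (f : C(Metric.sphere (0 : V) 1, ℝ)) {ε : ℝ}
    (hε : 0 < ε) :
    ∃ g ∈ latticeLinear V, ∀ x : Metric.sphere (0 : V) 1, |f x - g x| ≤ ε := by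
  let L : Set C(Metric.sphere (0 : V) 1, ℝ) := {f | ∃ g ∈ latticeLinear V, ∀ x, f x = g x}
  have htop : closure L = ⊤ := by
    refine ContinuousMap.sublattice_closure_eq_top L ⟨0, 0, zero_mem _, fun _ => rfl⟩ ?_ ?_ ?_
    · rintro f ⟨g, hg, hf⟩ f' ⟨g', hg', hf'⟩
      exact ⟨g ⊓ g', (latticeLinear V).inf_mem hg hg', fun x => by
        rw [ContinuousMap.inf_apply, hf, hf', Pi.inf_apply]⟩
    · rintro f ⟨g, hg, hf⟩ f' ⟨g', hg', hf'⟩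
      exact ⟨g ⊔ g', (latticeLinear V).sup_mem hg hg', fun x => by
        rw [ContinuousMap.sup_apply, hf, hf', Pi.sup_apply]⟩
    · intro v x y
      obtain ⟨g, hg, hx, hy⟩ := exists_latticeLinear_interpolating v x y
      exact ⟨⟨fun z => g z, (continuous_of_mem_latticeLinear hg).comp continuous_subtype_val⟩,
        ⟨g, hg, fun _ => rfl⟩, hx, hy⟩
  obtain ⟨f', ⟨g, hg, hf'⟩, hdist⟩ :=
    Metric.mem_closure_iff.1 (htop ▸ Set.mem_univ f : f ∈ closure L) ε hε
  exact ⟨g, hg, fun x => hf' x ▸ (ContinuousMap.dist_apply_le_dist x).trans hdist.le⟩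

theorem PosHomogeneous.exists_latticeLinear_approx {f : V → ℝ} (hf : PosHomogeneous f)
    (hc : Continuous f) {ε : ℝ} (hε : 0 < ε) :
    ∃ g ∈ latticeLinear V, ∀ x, |f x - g x| ≤ ε * ‖x‖ := by
  obtain ⟨g, hg, hfg⟩ :=
    exists_latticeLinear_approx_on_sphere ⟨_, hc.comp continuous_subtype_val⟩ hε
  exact ⟨g, hg, hf.abs_sub_le_mul_norm (posHomogeneous_of_mem_latticeLinear hg) fun x hx =>
    hfg ⟨x, mem_sphere_zero_iff_norm.2 hx⟩⟩

end Approximation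

end LatticeLinear

section Calculus

variable {E F : Type*} [AddCommGroup E] [Lattice E] [Module ℝ E]
  [AddCommGroup F] [Lattice F] [Module ℝ F]

section Approximation

variable {ι : Type*}

theorem exists_forall_hom_eq_linear [Finite ι] (a : ι → E) (f : EuclideanSpace ℝ ι →L[ℝ] ℝ) :
    ∃ y : E, ∀ ω : VLHom E ℝ, ω y = f (WithLp.toLp 2 fun i => ω (a i)) := by
  classical
  have := Fintype.ofFinite ι
  refine ⟨∑ i, f (EuclideanSpace.single i 1) • a i, fun ω => ?_⟩
  rw [← (EuclideanSpace.basisFun ι ℝ).sum_repr (WithLp.toLp 2 fun i => ω (a i))]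
  simp only [map_sum, map_smul, smul_eq_mul, EuclideanSpace.basisFun_repr,
    EuclideanSpace.basisFun_apply, mul_comm]

theorem exists_forall_hom_eq_latticeLinear [Finite ι] (a : ι → E) {g : EuclideanSpace ℝ ι → ℝ}
    (hg : g ∈ latticeLinear (EuclideanSpace ℝ ι)) :
    ∃ y : E, ∀ ω : VLHom E ℝ, ω y = g (WithLp.toLp 2 fun i => ω (a i)) :=
  hg { carrier := {g | ∃ y : E, ∀ ω : VLHom E ℝ, ω y = g (WithLp.toLp 2 fun i => ω (a i))}
       add_mem' := fun ⟨y, hy⟩ ⟨z, hz⟩ => ⟨y + z, fun ω => by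
        rw [map_add, hy, hz, Pi.add_apply]⟩
       zero_mem' := ⟨0, fun ω => map_zero ω⟩
       smul_mem' := fun c _ ⟨y, hy⟩ => ⟨c • y, fun ω => by rw [map_smul, hy, Pi.smul_apply]⟩
       sup_mem' := fun _ _ ⟨y, hy⟩ ⟨z, hz⟩ => ⟨y ⊔ z, fun ω => by
        rw [map_sup, hy, hz, Pi.sup_apply]⟩
       inf_mem' := fun _ _ ⟨y, hy⟩ ⟨z, hz⟩ => ⟨y ⊓ z, fun ω => by
        rw [map_inf, hy, hz, Pi.inf_apply]⟩ } <| by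
    rintro _ ⟨f, rfl⟩
    exact exists_forall_hom_eq_linear a f

variable [Fintype ι]

theorem euclideanNorm_le_sum_abs (x : EuclideanSpace ℝ ι) : ‖x‖ ≤ ∑ i, |x i| := by
  have hsum : 0 ≤ ∑ i, |x i| := Finset.sum_nonneg fun i _ => abs_nonneg (x i)
  refine (sq_le_sq₀ (norm_nonneg x) hsum).1 ?_
  rw [EuclideanSpace.norm_sq_eq]
  exact Finset.sum_sq_le_sq_sum_of_nonneg fun i _ => abs_nonneg (x i)

variable {h : (ι → ℝ) → ℝ}

theorem PosHomogeneous.exists_hom_approx (hh : PosHomogeneous h) (hc : Continuous h) (a : ι → E)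
    {ε : ℝ} (hε : 0 < ε) :
    ∃ y : E, ∀ ω : VLHom E ℝ, |h (fun i => ω (a i)) - ω y| ≤ ε * ω (∑ i, |a i|) := by
  have hh' : PosHomogeneous fun x : EuclideanSpace ℝ ι => h x.ofLp := fun c x => hh c x.ofLp
  obtain ⟨g, hg, hhg⟩ := hh'.exists_latticeLinear_approx
    (hc.comp (PiLp.continuous_ofLp 2 fun _ => ℝ)) hε
  obtain ⟨y, hy⟩ := exists_forall_hom_eq_latticeLinear a hg
  refine ⟨y, fun ω => ?_⟩
  rw [hy ω, map_sum]
  simp only [ω.map_abs]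
  exact (hhg (WithLp.toLp 2 fun i => ω (a i))).trans
    (mul_le_mul_of_nonneg_left (euclideanNorm_le_sum_abs _) hε.le)

theorem hom_sum_abs_nonneg (a : ι → E) (ω : VLHom E ℝ) : 0 ≤ ω (∑ i, |a i|) := by
  rw [map_sum]
  exact Finset.sum_nonneg fun i _ => (abs_nonneg (ω (a i))).trans_eq (ω.map_abs (a i)).symm

theorem PosHomogeneous.exists_seq_hom_approx (hh : PosHomogeneous h) (hc : Continuous h)
    (a : ι → E) :
    ∃ y : ℕ → E, ∀ ε : ℝ, 0 < ε → ∃ N, ∀ n, N ≤ n → ∀ ω : VLHom E ℝ,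
      |ω (y n) - h (fun i => ω (a i))| ≤ ε * ω (∑ i, |a i|) := by
  choose y hy using fun n : ℕ => hh.exists_hom_approx hc a (Nat.one_div_pos_of_nat (n := n))
  refine ⟨y, fun ε hε => ?_⟩
  obtain ⟨N, hN⟩ := exists_nat_one_div_lt hε
  refine ⟨N, fun n hn ω => ?_⟩
  rw [abs_sub_comm]
  exact (hy n ω).trans (mul_le_mul_of_nonneg_right
    ((Nat.one_div_le_one_div hn).trans hN.le) (hom_sum_abs_nonneg a ω))

end Approximation

variable {h : HFun}

theorem CalcEq.apply_of_mem {a : Fin h.arity → E} {b : E} (hab : CalcEq h a b)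
    {L : VectorSublattice E} (ω : VLHom L ℝ) (ha : ∀ i, a i ∈ L) (hb : b ∈ L) :
    h.toFun (fun i => ω ⟨a i, ha i⟩) = ω ⟨b, hb⟩ := by
  have hL : (VectorSublattice.closure (Set.range a ∪ {b}) : Set E) ⊆ L := by
    refine VectorSublattice.closure_le ?_
    rintro _ (⟨i, rfl⟩ | rfl)
    · exact ha i
    · exact hb
  let ω' := ω.comp (VectorSublattice.inclusion hL)
  by_cases hω : ∃ x, ω' x ≠ 0
  · exact hab ω' hω
  · push Not at hω
    have ha0 : ∀ i, ω ⟨a i, ha i⟩ = 0 := fun i =>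
      hω ⟨a i, VectorSublattice.subset_closure _ (Or.inl ⟨i, rfl⟩)⟩
    have hb0 : ω ⟨b, hb⟩ = 0 := hω ⟨b, VectorSublattice.subset_closure _ (Or.inr rfl)⟩
    rw [funext ha0, hb0]
    exact PosHomogeneous.map_zero h.homogeneous

theorem CalcEq.map {a : Fin h.arity → E} {b : E} (hab : CalcEq h a b) (T : VLHom E F) :
    CalcEq h (fun i => T (a i)) (T b) := fun ω _ =>
  let C := VectorSublattice.closure (Set.range (fun i => T (a i)) ∪ {T b})
  let L := VectorSublattice.comap T C
  hab.apply_of_mem (L := L) (ω.comp ((T.comp L.subtype).codRestrict C fun x => x.2))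
    (fun i => VectorSublattice.subset_closure _ (Or.inl ⟨i, rfl⟩))
    (VectorSublattice.subset_closure _ (Or.inr rfl))

theorem CalcEq.of_map_injective {T : VLHom E F} (hT : Function.Injective T)
    {a : Fin h.arity → E} {b : E} (hab : CalcEq h (fun i => T (a i)) (T b)) : CalcEq h a b := by
  intro ω _
  let C := VectorSublattice.closure (Set.range a ∪ {b})
  let M := VectorSublattice.map T C
  have hTC : Function.Injective (T.comp C.subtype) := hT.comp Subtype.val_injective
  let R : VLHom M C := VLHom.lift (T.comp C.subtype) hTC M.subtype fun y => y.2
  have hR (x : C) : R ⟨T x, ⟨x, rfl⟩⟩ = x := hTC (VLHom.apply_lift _ _ _ _ _)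
  have ha (i) : a i ∈ C := VectorSublattice.subset_closure _ (Or.inl ⟨i, rfl⟩)
  have hb : b ∈ C := VectorSublattice.subset_closure _ (Or.inr rfl)
  have key := hab.apply_of_mem (ω.comp R) (fun i => ⟨⟨a i, ha i⟩, rfl⟩) ⟨⟨b, hb⟩, rfl⟩
  simp only [VLHom.comp_apply] at key
  rw [hR ⟨b, hb⟩, funext fun i => congrArg ω (hR ⟨a i, ha i⟩)] at key
  exact key

variable [IsOrderedAddMonoid E] [IsOrderedModule ℝ E]

theorem CalcEq.unique (hE : IsArchimedean E) {a : Fin h.arity → E} {b c : E}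
    (hb : CalcEq h a b) (hc : CalcEq h a c) : b = c := by
  let A : Set E := Set.range a ∪ {b, c}
  have hA : A.Countable := (Set.countable_range a).union ((Set.countable_singleton c).insert b)
  have ha : ∀ i, a i ∈ VectorSublattice.closure A := fun i =>
    VectorSublattice.subset_closure _ (Or.inl ⟨i, rfl⟩)
  have hbA : b ∈ VectorSublattice.closure A :=
    VectorSublattice.subset_closure _ (Or.inr (Or.inl rfl))
  have hcA : c ∈ VectorSublattice.closure A :=
    VectorSublattice.subset_closure _ (Or.inr (Or.inr rfl))
  exact congrArg Subtype.val (hE.eq_of_forall_hom hA (y := ⟨b, hbA⟩) (z := ⟨c, hcA⟩) fun ω =>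
    (hb.apply_of_mem ω ha hbA).symm.trans (hc.apply_of_mem ω ha hcA))

theorem IsArchimedean.ruCauchyBy_of_forall_hom (hE : IsArchimedean E) {A : Set E}
    (hA : A.Countable) {p : VectorSublattice.closure A} {y : ℕ → VectorSublattice.closure A}
    {r : VLHom (VectorSublattice.closure A) ℝ → ℝ}
    (h : ∀ ε : ℝ, 0 < ε → ∃ N, ∀ n, N ≤ n → ∀ ω : VLHom (VectorSublattice.closure A) ℝ,
      |ω (y n) - r ω| ≤ ε * ω p) : RUCauchyBy p y := by
  intro ε hε
  obtain ⟨N, hN⟩ := h (ε / 2) (half_pos hε)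
  refine ⟨N, fun m n hm hn => hE.le_of_forall_hom hA fun ω => ?_⟩
  calc ω |y m - y n| = |ω (y m) - ω (y n)| := by rw [ω.map_abs, map_sub]
    _ ≤ |ω (y m) - r ω| + |r ω - ω (y n)| := abs_sub_le _ _ _
    _ ≤ ε / 2 * ω p + ε / 2 * ω p :=
      add_le_add (hN m hm ω) (abs_sub_comm (r ω) _ ▸ hN n hn ω)
    _ = ω (ε • p) := by rw [← add_mul, add_halves, map_smul, smul_eq_mul]

theorem UniformlyComplete.exists_calcEq (hE : IsArchimedean E) (hc : UniformlyComplete E)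
    (h : HFun) (a : Fin h.arity → E) : ∃ b, CalcEq h a b := by
  let C := VectorSublattice.closure (Set.range a)
  let a' : Fin h.arity → C := fun i => ⟨a i, VectorSublattice.subset_closure _ ⟨i, rfl⟩⟩
  let p : C := ∑ i, |a' i|
  obtain ⟨y, hy⟩ := PosHomogeneous.exists_seq_hom_approx h.homogeneous h.continuous a'
  have hcauchy : RUCauchyBy (p : E) fun n => (y n : E) :=
    hE.ruCauchyBy_of_forall_hom (Set.countable_range a) hy
  obtain ⟨b, hb⟩ := hc.exists_ruBy hE hcauchy
  refine ⟨b, fun ω _ => ?_⟩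
  have hCM : (C : Set E) ⊆ VectorSublattice.closure (Set.range a ∪ {b}) :=
    VectorSublattice.closure_mono Set.subset_union_left
  let ω' : VLHom C ℝ := ω.comp (VectorSublattice.inclusion hCM)
  have hωb : RUBy (ω' p) (fun n => ω' (y n))
      (ω ⟨b, VectorSublattice.subset_closure _ (Or.inr rfl)⟩) :=
    RUBy.map (p := VectorSublattice.inclusion hCM p)
      (f := fun n => VectorSublattice.inclusion hCM (y n)) (g := ⟨b, _⟩) ω hb
  have hωh : RUBy (ω' p) (fun n => ω' (y n)) (h.toFun fun i => ω' (a' i)) := fun ε hε =>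
    (hy ε hε).imp fun N hN n hn => hN n hn ω'
  exact isArchimedean_real.eq_of_ruBy hωh hωb

end Calculus

section Hull

variable {E G F : Type*} [AddCommGroup E] [Lattice E] [Module ℝ E]
  [AddCommGroup G] [Lattice G] [Module ℝ G]
  [AddCommGroup F] [Lattice F] [Module ℝ F] {D : Set HFun} {φ : VLHom E G}

theorem dChain_mono (D : Set HFun) (φ : VLHom E G) {m n : ℕ} (hmn : m ≤ n) :
    (dChain D φ m : Set G) ⊆ dChain D φ n :=
  monotone_nat_of_le_succ (f := fun n => (dChain D φ n : Set G)) (dChain_subset_succ D φ) hmn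

theorem mem_dHull {y : G} : y ∈ dHull D φ ↔ ∃ n, y ∈ dChain D φ n := Iff.rfl

theorem mem_dHull_of_calcEq {h : HFun} (hh : h ∈ D) {a : Fin h.arity → G}
    (ha : ∀ i, a i ∈ dHull D φ) {b : G} (hab : CalcEq h a b) : b ∈ dHull D φ := by
  choose n hn using fun i => mem_dHull.1 (ha i)
  have hsup : ∀ i, a i ∈ dChain D φ (Finset.univ.sup n) := fun i =>
    dChain_mono D φ (Finset.le_sup (Finset.mem_univ i)) (hn i)
  exact mem_dHull.2 ⟨Finset.univ.sup n + 1,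
    VectorSublattice.subset_closure _ (Or.inr ⟨h, hh, a, hsup, hab⟩)⟩

theorem dHull_induction {L : VectorSublattice G} (hφ : ∀ x, φ x ∈ L)
    (hL : ∀ h ∈ D, ∀ (a : Fin h.arity → G) (b : G), (∀ i, a i ∈ dHull D φ) → b ∈ dHull D φ →
      (∀ i, a i ∈ L) → CalcEq h a b → b ∈ L) :
    (dHull D φ : Set G) ⊆ L := by
  suffices H : ∀ n, (dChain D φ n : Set G) ⊆ L from fun y ⟨n, hn⟩ => H n hn
  intro n
  induction n with
  | zero =>
    rintro _ ⟨x, rfl⟩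
    exact hφ x
  | succ n ih =>
    refine VectorSublattice.closure_le ?_
    rintro b (hb | ⟨h, hh, a, ha, hab⟩)
    · exact ih hb
    · have ha' : ∀ i, a i ∈ dHull D φ := fun i => ⟨n, ha i⟩
      exact hL h hh a b ha' (mem_dHull_of_calcEq hh ha' hab) (fun i => ih (ha i)) hab

theorem dHull_calcEq {h : HFun} {a : Fin h.arity → dHull D φ} {b : dHull D φ}
    (hab : CalcEq h (fun i => (a i : G)) b) : CalcEq h a b :=
  CalcEq.of_map_injective (T := (dHull D φ).subtype) Subtype.val_injective hab

theorem dComplete_dHull [IsOrderedAddMonoid G] [IsOrderedModule ℝ G] (hG : IsArchimedean G)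
    (hc : UniformlyComplete G) (D : Set HFun) (φ : VLHom E G) : DComplete (dHull D φ) D := by
  intro h hh a
  obtain ⟨b, hb⟩ := hc.exists_calcEq hG h fun i => (a i : G)
  exact ⟨⟨b, mem_dHull_of_calcEq hh (fun i => (a i).2) hb⟩, dHull_calcEq hb⟩

theorem eq_of_comp_toDHull_eq [IsOrderedAddMonoid F] [IsOrderedModule ℝ F]
    (hF : IsArchimedean F) {S T : VLHom (dHull D φ) F}
    (h : ∀ x, S (toDHull D φ x) = T (toDHull D φ x)) : S = T := by
  let L := VectorSublattice.map (dHull D φ).subtype (VectorSublattice.eqLocus S T)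
  have hL : ∀ z : dHull D φ, (z : G) ∈ L → S z = T z := fun z hz => by
    obtain ⟨z', hz', hzz⟩ := VectorSublattice.mem_map.1 hz
    obtain rfl : z' = z := Subtype.ext hzz
    exact hz'
  have hsub : (dHull D φ : Set G) ⊆ L := by
    refine dHull_induction (fun x => VectorSublattice.mem_map.2 ⟨toDHull D φ x, h x, rfl⟩) ?_
    intro k _ a b ha hb haL hab
    let a' : Fin k.arity → dHull D φ := fun i => ⟨a i, ha i⟩
    have hab' : CalcEq k a' ⟨b, hb⟩ := dHull_calcEq hab
    have hST : (fun i => S (a' i)) = fun i => T (a' i) := funext fun i => hL (a' i) (haL i)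
    have hSb : CalcEq k (fun i => T (a' i)) (S ⟨b, hb⟩) := hST ▸ hab'.map S
    exact VectorSublattice.mem_map.2 ⟨⟨b, hb⟩, hSb.unique hF (hab'.map T), rfl⟩
  exact VLHom.ext fun z => hL z (hsub z.2)

theorem exists_extension_dHull {V : Type*} [AddCommGroup V] [Lattice V] [Module ℝ V]
    [IsOrderedAddMonoid V] [IsOrderedModule ℝ V] (hV : IsArchimedean V) (hFD : DComplete F D)
    {j : VLHom F V} (hj : Function.Injective j) (S : VLHom G V) {T : VLHom E F}
    (hST : ∀ x, S (φ x) = j (T x)) : ∃ R : VLHom (dHull D φ) F, ∀ x, R (toDHull D φ x) = T x := by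
  have hmem : (dHull D φ : Set G) ⊆ VectorSublattice.comap S j.range := by
    refine dHull_induction (fun x => ⟨T x, (hST x).symm⟩) fun h hh a b _ _ ha hab => ?_
    choose c hc using ha
    obtain ⟨d, hd⟩ := hFD h hh c
    have hjd : CalcEq h (fun i => S (a i)) (j d) := funext hc ▸ hd.map j
    exact ⟨d, hjd.unique hV (hab.map S)⟩
  exact ⟨VLHom.lift j hj (S.comp (dHull D φ).subtype) fun y => hmem y.2,
    fun x => hj ((VLHom.apply_lift _ _ _ _ _).trans (hST x))⟩

end Hull

section DCompletion

variable {E : Type u} [AddCommGroup E] [Lattice E] [Module ℝ E]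
  {U : Type v} [AddCommGroup U] [Lattice U] [Module ℝ U]
  [IsOrderedAddMonoid U] [IsOrderedModule ℝ U]

/-- The target `F` may lie in a larger universe than `E`, so the universal property of `φ` is only
applied to `uniformCompletion E`, whence `germMap T` leads into germs on `F`. -/
theorem IsUniformCompletion.isDCompletion_toDHull {φ : VLHom E U}
    (hφ : IsUniformCompletion.{u, v, u} φ) (D : Set HFun) :
    IsDCompletion.{u, v, w} D (toDHull D φ) where
  archimedean := (dHull D φ).isArchimedean hφ.archimedean
  dComplete := dComplete_dHull hφ.archimedean hφ.uniformlyComplete D φ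
  injective _ _ h := hφ.injective (congrArg Subtype.val h)
  universal F _ _ _ _ _ hF hFD T := by
    obtain ⟨R, hR, -⟩ := hφ.universal (uniformCompletion E) (isArchimedean_uniformCompletion E)
      (uniformlyComplete_uniformCompletion E) (toUniformCompletion E)
    let Q : VLHom U (Filter.Germ (homFilter F) ℝ) :=
      (germMap T).comp ((uniformCompletion E).subtype.comp R)
    have hQ : ∀ x, Q (φ x) = evalGerm F (T x) := fun x =>
      (congrArg (fun y => germMap T ((uniformCompletion E).subtype y)) (hR x)).trans
        (germMap_evalGerm T x)
    obtain ⟨S, hS⟩ := exists_extension_dHull isArchimedean_germ hFD hF.evalGerm_injective Q hQ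
    exact ⟨S, hS, fun S' hS' => eq_of_comp_toDHull_eq hF fun x => (hS' x).trans (hS x).symm⟩

theorem IsDCompletion.existsUnique_iso {D : Set HFun} {φ : VLHom E U} {G : Type v}
    [AddCommGroup G] [Lattice G] [Module ℝ G] [IsOrderedAddMonoid G] [IsOrderedModule ℝ G]
    {ψ : VLHom E G} (hφ : IsDCompletion.{u, v, v} D φ) (hψ : IsDCompletion.{u, v, v} D ψ) :
    ∃! e : VLHom U G, Function.Bijective e ∧ ∀ x, e (φ x) = ψ x := by
  obtain ⟨e, he, he_unique⟩ := hφ.universal G hψ.archimedean hψ.dComplete ψ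
  obtain ⟨f, hf, -⟩ := hψ.universal U hφ.archimedean hφ.dComplete φ
  have hfe : f.comp e = VLHom.id :=
    (hφ.universal U hφ.archimedean hφ.dComplete φ).unique
      (fun x => by rw [VLHom.comp_apply, he, hf]) fun _ => rfl
  have hef : e.comp f = VLHom.id :=
    (hψ.universal G hψ.archimedean hψ.dComplete ψ).unique
      (fun x => by rw [VLHom.comp_apply, hf, he]) fun _ => rfl
  exact ⟨e, ⟨Function.bijective_iff_has_inverse.2
    ⟨f, fun x => DFunLike.congr_fun hfe x, fun y => DFunLike.congr_fun hef y⟩, he⟩,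
    fun e' he' => he_unique e' he'.2⟩

end DCompletion

end FunctionalCompletion

theorem corollary3p19 (E : Type u) [AddCommGroup E] [Lattice E] [Module ℝ E]
    [IsOrderedAddMonoid E] [IsOrderedModule ℝ E] (hE : FunctionalCompletion.IsArchimedean E)
    (D : Set FunctionalCompletion.HFun) (hD : D.Nonempty) :
    -- a uniform completion of `E` exists
    (∃ (U : Type u) (_ : AddCommGroup U) (_ : Lattice U) (_ : Module ℝ U)
      (_ : IsOrderedAddMonoid U) (_ : IsOrderedModule ℝ U) (φ : FunctionalCompletion.VLHom E U),
      FunctionalCompletion.IsUniformCompletion.{u, u, max u w} φ) ∧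
    -- inside any uniform completion, `E^D` with the natural embedding is a `D`-completion, and
    -- every `D`-completion is isomorphic to it by a unique isomorphism over `E`
    ∀ (U : Type u) [AddCommGroup U] [Lattice U] [Module ℝ U] [IsOrderedAddMonoid U]
      [IsOrderedModule ℝ U] (φ : FunctionalCompletion.VLHom E U),
      FunctionalCompletion.IsUniformCompletion.{u, u, u} φ →
      FunctionalCompletion.IsDCompletion.{u, u, max u w} D (FunctionalCompletion.toDHull D φ) ∧
      ∀ (G : Type u) [AddCommGroup G] [Lattice G] [Module ℝ G] [IsOrderedAddMonoid G]
        [IsOrderedModule ℝ G] (ψ : FunctionalCompletion.VLHom E G),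
        FunctionalCompletion.IsDCompletion.{u, u, u} D ψ →
        ∃! e : FunctionalCompletion.VLHom (FunctionalCompletion.dHull D φ) G,
          Function.Bijective e ∧ ∀ x : E, e (FunctionalCompletion.toDHull D φ x) = ψ x :=
  ⟨⟨FunctionalCompletion.uniformCompletion E, inferInstance, inferInstance, inferInstance,
      inferInstance, inferInstance, FunctionalCompletion.toUniformCompletion E,
      hE.isUniformCompletion⟩,
    fun _ _ _ _ _ _ _ hφ => ⟨hφ.isDCompletion_toDHull D, fun _ _ _ _ _ _ _ hψ =>
      (hφ.isDCompletion_toDHull D).existsUnique_iso hψ⟩⟩
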